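/- Let $R$ be a coherent ring, i.e. a ring for which the categories of finitely presented left modules and of finitely presented right modules are both abelian. Write $\mathsf{Mod}(R)$ for the category of right $R$-modules and $\mathsf{Mod}(R^{op})$ for the category of left $R$-modules; functors are additive. For an abelian category $\mathcal A$, an additive functor $F\colon\mathcal A\to\mathsf{Ab}$ is finitely presented if there is a sequence $(Y,-)\to(X,-)\to F\to 0$ that is exact at every object of $\mathcal A$, where $(Y,-)\to(X,-)$ is induced by some $f\colon X\to Y$; its defect $w(F)$ is then $\ker f\in\mathcal A$ (up to isomorphism). Let $\mathsf{fp}(\mathcal A,\mathsf{Ab})$ be the category of finitely presented functors. A functor $F\colon\mathsf{Mod}(R)\to\mathsf{Ab}$ is totally finitely presented if it has such a presentation in which $X,Y$ are finitely presented modules. For $F\in\mathsf{fp}(\mathsf{Mod}(R),\mathsf{Ab})$, the dual $DF\in\mathsf{fp}(\mathsf{Mod}(R^{op}),\mathsf{Ab})$ is the value at $F$ of the zeroth left derived functor of the contravariant functor $G\mapsto(G(R),-)$: if $0\to F\to I^0\to I^1$ is exact with $I^0,I^1$ injective in $\mathsf{fp}(\mathsf{Mod}(R),\mathsf{Ab})$,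 then $DF=\operatorname{coker}\big((I^1(R),-)\to(I^0(R),-)\big)$, where $I^j(R)$ is a left $R$-module through the left multiplications of $R$. Finally $S_n$ and $S^n$ are the left and right satellites: $S_0F=S^0F=F$, $S_{n+1}=S_1S_n$, $S^{n+1}=S^1S^n$, with $0\to S_1F(X)\to F(\Omega X)\to F(P)$ and $F(I)\to F(\Sigma X)\to S^1F(X)\to0$ exact for short exact sequences $0\to\Omega X\to P\to X\to 0$ and $0\to X\to I\to\Sigma X\to0$ with $P$ projective and $I$ injective. (1) Let $F\colon\mathsf{Mod}(R)\to\mathsf{Ab}$ be totally finitely presented and $n\ge0$. Then $S_nF$ is finitely presented, an exact sequence $0\to F\to I^0\to I^1$ as above exists, and, for every choice of the presentation of $S_nF$ and of the sequence $0\to F\to I^0\to I^1$, there is an isomorphism of right $R$-modules $$w(S_nF)\;\cong\;S^n(DF)(R),$$ where $R$ acts on $S^n(DF)(R)$ through the right multiplications of $R$. (2) Let $M$ be a finitely presented left $R$-module and $n\ge 0$. Then $\operatorname{Tor}_n(-,M)\colon\mathsf{Mod}(R)\to\mathsf{Ab}$ is finitely presented, and there is an isomorphism of right $R$-modules $$w\big(\operatorname{Tor}_n(-,M)\big)\;\cong\;\operatorname{Ext}^n(M,R).$$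 -/

import Mathlib

open CategoryTheory CategoryTheory.Limits Opposite
open scoped TensorProduct

universe v u v' u'

noncomputable section

namespace FunctorDefect

/-! ### Finitely presented functors and their defect -/

section FinitelyPresented

variable {C : Type u} [Category.{v} C] [Abelian C]

/-- A presentation `(Y, -) ⟶ (X, -) ⟶ F ⟶ 0`, exact at every object of `C`. By the Yoneda lemma
every natural transformation `(Y, -) ⟶ (X, -)` is induced by a unique `f : X ⟶ Y`. -/
structure Presentation (F : C ⥤ AddCommGrpCat.{v}) where
  X : C
  Y : C
  f : X ⟶ Y
  π : preadditiveCoyoneda.obj (op X) ⟶ F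
  exact : ∀ A : C, Function.Exact ((preadditiveCoyoneda.map f.op).app A) (π.app A)
  surjective : ∀ A : C, Function.Surjective (π.app A)

/-- The defect `w(F)`, computed from the presentation `(f, -) : (Y, -) ⟶ (X, -)` of `F`.
The contravariant functor `w` is exact and `w(X, -) = X`, so `0 ⟶ w(F) ⟶ X ⟶ Y` is exact. -/
def Presentation.defect {F : C ⥤ AddCommGrpCat.{v}} (P : Presentation F) : C :=
  kernel P.f

variable (C) in
/-- The property of an additive functor `C ⥤+ Ab` of being finitely presented. -/
def isFinitelyPresented : ObjectProperty (C ⥤+ AddCommGrpCat.{v}) :=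
  fun F => Nonempty (Presentation F.obj)

variable (C) in
/-- The category `fp(C, Ab)` of finitely presented functors and natural transformations. -/
abbrev FP := (isFinitelyPresented C).FullSubcategory

/-- The natural transformation underlying a morphism of `fp(C, Ab)`. -/
abbrev FP.nat {F G : FP C} (α : F ⟶ G) : F.obj.obj ⟶ G.obj.obj := α.hom.hom

/-- An exact sequence `0 ⟶ F ⟶ I₀ ⟶ I₁` in `fp(C, Ab)` with `I₀` and `I₁` injective objects of
`fp(C, Ab)`, that is, the beginning of an injective resolution of `F` in `fp(C, Ab)`. Exactness in
`fp(C, Ab)` is exactness at every object of `C`. -/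
structure InjectiveCopresentation (F : FP C) where
  I₀ : FP C
  I₁ : FP C
  injective₀ : Injective I₀
  injective₁ : Injective I₁
  ι : F ⟶ I₀
  d : I₀ ⟶ I₁
  injective : ∀ A : C, Function.Injective ((FP.nat ι).app A)
  exact : ∀ A : C, Function.Exact ((FP.nat ι).app A) ((FP.nat d).app A)

/-- The functor `coker ((f, -) : (Y, -) ⟶ (X, -))`. -/
def coker {X Y : C} (f : X ⟶ Y) : C ⥤ AddCommGrpCat.{v} :=
  cokernel (preadditiveCoyoneda.map f.op)

/-- A quotient of an additive functor is additive. -/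
theorem additive_of_surjective {F G : C ⥤ AddCommGrpCat.{v}} [F.Additive] (π : F ⟶ G)
    (h : ∀ A : C, Function.Surjective (π.app A)) : G.Additive where
  map_add {A B f g} := by
    have : Epi (π.app A) := (AddCommGrpCat.epi_iff_surjective _).2 (h A)
    rw [← cancel_epi (π.app A)]
    simp only [Preadditive.comp_add, ← NatTrans.naturality, Functor.map_add,
      Preadditive.add_comp]

def cokerPresentation {X Y : C} (f : X ⟶ Y) : Presentation (coker f) where
  X := X
  Y := Y
  f := f
  π := cokernel.π (preadditiveCoyoneda.map f.op)
  exact A := by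
    let S := ShortComplex.mk _ _ (cokernel.condition (preadditiveCoyoneda.map f.op))
    have hS : S.Exact := ShortComplex.exact_cokernel _
    have h2 := hS.map ((evaluation C AddCommGrpCat.{v}).obj A)
    exact (ShortComplex.ab_exact_iff_function_exact _).1 h2
  surjective A := (AddCommGrpCat.epi_iff_surjective _).1
    (inferInstance : Epi ((cokernel.π (preadditiveCoyoneda.map f.op)).app A))

instance {X Y : C} (f : X ⟶ Y) : (coker f).Additive :=
  additive_of_surjective (cokerPresentation f).π (cokerPresentation f).surjective

/-- `coker (f, -)` as an object of `fp(C, Ab)`. -/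
def FP.coker {X Y : C} (f : X ⟶ Y) : FP C :=
  ⟨AdditiveFunctor.of (FunctorDefect.coker f), ⟨cokerPresentation f⟩⟩

end FinitelyPresented

/-! ### Satellites -/

section Satellites

variable {C : Type u} [Category.{v} C] [Abelian C] {D : Type u'} [Category.{v'} D] [Abelian D]

section Left

variable [EnoughProjectives C]

/-- The chosen syzygy `ΩX`, with `0 ⟶ ΩX ⟶ P ⟶ X ⟶ 0` exact and `P` projective. -/
abbrev syz (X : C) : C := kernel (Projective.π X)

/-- The chosen inclusion `ΩX ⟶ P`. -/
abbrev syzι (X : C) : syz X ⟶ Projective.over X := kernel.ι (Projective.π X)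

/-- A lift of `f : X ⟶ X'` to the chosen projectives. -/
def syzLift {X X' : C} (f : X ⟶ X') : Projective.over X ⟶ Projective.over X' :=
  Projective.factorThru (Projective.π X ≫ f) (Projective.π X')

lemma syzLift_π {X X' : C} (f : X ⟶ X') :
    syzLift f ≫ Projective.π X' = Projective.π X ≫ f :=
  Projective.factorThru_comp _ _

/-- The map `ΩX ⟶ ΩX'` induced by `f : X ⟶ X'` and the chosen lift. -/
def syzMap {X X' : C} (f : X ⟶ X') : syz X ⟶ syz X' :=
  kernel.map _ _ (syzLift f) f (syzLift_π f).symm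

lemma syzMap_ι {X X' : C} (f : X ⟶ X') : syzMap f ≫ syzι X' = syzι X ≫ syzLift f := by
  simp [syzMap]

/-- Two maps of syzygies that lift the same map agree on `ker (F(ΩX) ⟶ F(P))`. -/
lemma left_indep (F : C ⥤+ D) {X X' : C} {f : X ⟶ X'}
    (l₁ l₂ : Projective.over X ⟶ Projective.over X') (k₁ k₂ : syz X ⟶ syz X')
    (h₁ : l₁ ≫ Projective.π X' = Projective.π X ≫ f)
    (h₂ : l₂ ≫ Projective.π X' = Projective.π X ≫ f)
    (e₁ : k₁ ≫ syzι X' = syzι X ≫ l₁) (e₂ : k₂ ≫ syzι X' = syzι X ≫ l₂) :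
    kernel.ι (F.obj.map (syzι X)) ≫ F.obj.map k₁ =
      kernel.ι (F.obj.map (syzι X)) ≫ F.obj.map k₂ := by
  let s : Projective.over X ⟶ syz X' :=
    kernel.lift _ (l₁ - l₂) (by rw [Preadditive.sub_comp, h₁, h₂, sub_self])
  have hs : k₁ = k₂ + syzι X ≫ s := by
    rw [← cancel_mono (syzι X')]
    simp [s, e₁, e₂]
  rw [hs, Functor.map_add, Functor.map_comp, Preadditive.comp_add, kernel.condition_assoc,
    zero_comp, add_zero]

/-- The action of the left satellite on morphisms. -/
def leftSatelliteMap (F : C ⥤+ D) {X X' : C} (f : X ⟶ X') :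
    kernel (F.obj.map (syzι X)) ⟶ kernel (F.obj.map (syzι X')) :=
  kernel.map _ _ (F.obj.map (syzMap f)) (F.obj.map (syzLift f))
    (by rw [← Functor.map_comp, ← Functor.map_comp, syzMap_ι])

lemma leftSatelliteMap_ι (F : C ⥤+ D) {X X' : C} (f : X ⟶ X') :
    leftSatelliteMap F f ≫ kernel.ι (F.obj.map (syzι X')) =
      kernel.ι (F.obj.map (syzι X)) ≫ F.obj.map (syzMap f) := by
  simp [leftSatelliteMap]

/-- The left satellite `S₁F`, with `0 ⟶ S₁F(X) ⟶ F(ΩX) ⟶ F(P)` exact. -/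
def leftSatelliteOne (F : C ⥤+ D) : C ⥤ D where
  obj X := kernel (F.obj.map (syzι X))
  map f := leftSatelliteMap F f
  map_id X := by
    rw [← cancel_mono (kernel.ι _), leftSatelliteMap_ι,
      left_indep F (f := 𝟙 X) (syzLift (𝟙 X)) (𝟙 _) (syzMap (𝟙 X)) (𝟙 _)
        (syzLift_π _) (by simp) (syzMap_ι _) (by simp)]
    simp
  map_comp {X Y Z} f g := by
    rw [← cancel_mono (kernel.ι _), leftSatelliteMap_ι, Category.assoc, leftSatelliteMap_ι,
      ← Category.assoc, leftSatelliteMap_ι, Category.assoc, ← Functor.map_comp]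
    refine left_indep F (f := f ≫ g) (syzLift (f ≫ g)) (syzLift f ≫ syzLift g) _ _
        (syzLift_π _) ?_ (syzMap_ι _) ?_
    · rw [Category.assoc, syzLift_π, ← Category.assoc, syzLift_π, Category.assoc]
    · rw [Category.assoc, syzMap_ι, ← Category.assoc, syzMap_ι, Category.assoc]

instance (F : C ⥤+ D) : (leftSatelliteOne F).Additive where
  map_add {X Y f g} := by
    change leftSatelliteMap F (f + g) = leftSatelliteMap F f + leftSatelliteMap F g
    rw [← cancel_mono (kernel.ι _), Preadditive.add_comp]
    simp only [leftSatelliteMap_ι]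
    rw [← Preadditive.comp_add, ← Functor.map_add]
    refine left_indep F (f := f + g) (syzLift (f + g)) (syzLift f + syzLift g) _ _
        (syzLift_π _) ?_ (syzMap_ι _) ?_
    · simp only [Preadditive.add_comp, Preadditive.comp_add, syzLift_π]
    · simp only [Preadditive.add_comp, Preadditive.comp_add, syzMap_ι]

/-- The left satellites `Sₙ`: `S₀F = F` and `Sₙ₊₁F = S₁(SₙF)`. -/
def leftSatellite : ℕ → (C ⥤+ D) → (C ⥤+ D)
  | 0, F => F
  | n + 1, F => AdditiveFunctor.of (leftSatelliteOne (leftSatellite n F))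

end Left

section Right

variable [EnoughInjectives C]

/-- The chosen cosyzygy `ΣX`, with `0 ⟶ X ⟶ I ⟶ ΣX ⟶ 0` exact and `I` injective. -/
abbrev cosyz (X : C) : C := cokernel (Injective.ι X)

/-- The chosen projection `I ⟶ ΣX`. -/
abbrev cosyzπ (X : C) : Injective.under X ⟶ cosyz X := cokernel.π (Injective.ι X)

/-- An extension of `f : X ⟶ X'` to the chosen injectives. -/
def cosyzExt {X X' : C} (f : X ⟶ X') : Injective.under X ⟶ Injective.under X' :=
  Injective.factorThru (f ≫ Injective.ι X') (Injective.ι X)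

lemma ι_cosyzExt {X X' : C} (f : X ⟶ X') :
    Injective.ι X ≫ cosyzExt f = f ≫ Injective.ι X' :=
  Injective.comp_factorThru _ _

/-- The map `ΣX ⟶ ΣX'` induced by `f : X ⟶ X'` and the chosen extension. -/
def cosyzMap {X X' : C} (f : X ⟶ X') : cosyz X ⟶ cosyz X' :=
  cokernel.map _ _ f (cosyzExt f) (ι_cosyzExt f)

lemma π_cosyzMap {X X' : C} (f : X ⟶ X') :
    cosyzπ X ≫ cosyzMap f = cosyzExt f ≫ cosyzπ X' := by
  simp [cosyzMap]

/-- Two maps of cosyzygies that extend the same map agree in `coker (F(I) ⟶ F(ΣX'))`. -/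
lemma right_indep (F : C ⥤+ D) {X X' : C} {f : X ⟶ X'}
    (l₁ l₂ : Injective.under X ⟶ Injective.under X') (k₁ k₂ : cosyz X ⟶ cosyz X')
    (h₁ : Injective.ι X ≫ l₁ = f ≫ Injective.ι X')
    (h₂ : Injective.ι X ≫ l₂ = f ≫ Injective.ι X')
    (e₁ : cosyzπ X ≫ k₁ = l₁ ≫ cosyzπ X') (e₂ : cosyzπ X ≫ k₂ = l₂ ≫ cosyzπ X') :
    F.obj.map k₁ ≫ cokernel.π (F.obj.map (cosyzπ X')) =
      F.obj.map k₂ ≫ cokernel.π (F.obj.map (cosyzπ X')) := by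
  let s : cosyz X ⟶ Injective.under X' :=
    cokernel.desc _ (l₁ - l₂) (by rw [Preadditive.comp_sub, h₁, h₂, sub_self])
  have hs : k₁ = k₂ + s ≫ cosyzπ X' := by
    rw [← cancel_epi (cosyzπ X)]
    simp [s, e₁, e₂]
  rw [hs, Functor.map_add, Functor.map_comp, Preadditive.add_comp, Category.assoc,
    cokernel.condition, comp_zero, add_zero]

/-- The action of the right satellite on morphisms. -/
def rightSatelliteMap (F : C ⥤+ D) {X X' : C} (f : X ⟶ X') :
    cokernel (F.obj.map (cosyzπ X)) ⟶ cokernel (F.obj.map (cosyzπ X')) :=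
  cokernel.map _ _ (F.obj.map (cosyzExt f)) (F.obj.map (cosyzMap f))
    (by rw [← Functor.map_comp, ← Functor.map_comp, π_cosyzMap])

lemma π_rightSatelliteMap (F : C ⥤+ D) {X X' : C} (f : X ⟶ X') :
    cokernel.π (F.obj.map (cosyzπ X)) ≫ rightSatelliteMap F f =
      F.obj.map (cosyzMap f) ≫ cokernel.π (F.obj.map (cosyzπ X')) := by
  simp [rightSatelliteMap]

/-- The right satellite `S¹F`, with `F(I) ⟶ F(ΣX) ⟶ S¹F(X) ⟶ 0` exact. -/
def rightSatelliteOne (F : C ⥤+ D) : C ⥤ D where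
  obj X := cokernel (F.obj.map (cosyzπ X))
  map f := rightSatelliteMap F f
  map_id X := by
    rw [← cancel_epi (cokernel.π _), π_rightSatelliteMap,
      right_indep F (f := 𝟙 X) (cosyzExt (𝟙 X)) (𝟙 _) (cosyzMap (𝟙 X)) (𝟙 _)
        (ι_cosyzExt _) (by simp) (π_cosyzMap _) (by simp)]
    simp
  map_comp {X Y Z} f g := by
    rw [← cancel_epi (cokernel.π _), π_rightSatelliteMap, ← Category.assoc, π_rightSatelliteMap,
      Category.assoc, π_rightSatelliteMap, ← Category.assoc, ← Functor.map_comp]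
    refine right_indep F (f := f ≫ g) (cosyzExt (f ≫ g)) (cosyzExt f ≫ cosyzExt g) _ _
        (ι_cosyzExt _) ?_ (π_cosyzMap _) ?_
    · rw [← Category.assoc, ι_cosyzExt, Category.assoc, ι_cosyzExt, Category.assoc]
    · rw [← Category.assoc, π_cosyzMap, Category.assoc, π_cosyzMap, Category.assoc]

instance (F : C ⥤+ D) : (rightSatelliteOne F).Additive where
  map_add {X Y f g} := by
    change rightSatelliteMap F (f + g) = rightSatelliteMap F f + rightSatelliteMap F g
    rw [← cancel_epi (cokernel.π _), Preadditive.comp_add]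
    simp only [π_rightSatelliteMap]
    rw [← Preadditive.add_comp, ← Functor.map_add]
    refine right_indep F (f := f + g) (cosyzExt (f + g)) (cosyzExt f + cosyzExt g) _ _
        (ι_cosyzExt _) ?_ (π_cosyzMap _) ?_
    · simp only [Preadditive.add_comp, Preadditive.comp_add, ι_cosyzExt]
    · simp only [Preadditive.add_comp, Preadditive.comp_add, π_cosyzMap]

/-- The right satellites `Sⁿ`: `S⁰F = F` and `Sⁿ⁺¹F = S¹(SⁿF)`. -/
def rightSatellite : ℕ → (C ⥤+ D) → (C ⥤+ D)
  | 0, F => F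
  | n + 1, F => AdditiveFunctor.of (rightSatelliteOne (rightSatellite n F))

end Right

end Satellites

/-! ### Modules

Left `R`-modules are objects of `ModuleCat R`, right `R`-modules are objects of
`ModuleCat Rᵐᵒᵖ`. -/

section Modules

variable (R : Type u) [Ring R]

/-- The category of finitely presented left `R`-modules. -/
abbrev FPMod :=
  ObjectProperty.FullSubcategory
    (fun M : ModuleCat.{u} R => Module.FinitePresentation R M)

/-- `R` is (two-sided) coherent: the category of finitely presented left modules and the
category of finitely presented right modules are both abelian. -/
def IsCoherentRing : Prop :=
  Nonempty (Abelian (FPMod R)) ∧ Nonempty (Abelian (FPMod Rᵐᵒᵖ))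

variable {R}

/-- A functor with a presentation `(Y, -) ⟶ (X, -) ⟶ F ⟶ 0` in which the modules `X` and `Y` are
finitely presented. -/
def IsTotallyFinitelyPresented (F : ModuleCat.{u} R ⥤ AddCommGrpCat.{u}) : Prop :=
  ∃ P : Presentation F, Module.FinitePresentation R P.X ∧ Module.FinitePresentation R P.Y

variable (R) in
/-- `R` as a left module. -/
abbrev leftReg : ModuleCat.{u} R := ModuleCat.of R R

variable (R) in
/-- `R` as a right module. -/
abbrev rightReg : ModuleCat.{u} Rᵐᵒᵖ := ModuleCat.of Rᵐᵒᵖ R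

/-- Right multiplication by `r`, an endomorphism of the left module `R`. -/
def mulRightHom (r : R) : leftReg R ⟶ leftReg R :=
  ModuleCat.ofHom
    { toFun := fun s => s * r
      map_add' := fun a b => add_mul a b r
      map_smul' := fun a b => mul_assoc a b r }

/-- Left multiplication by `r`, an endomorphism of the right module `R`. -/
def mulLeftHom (r : R) : rightReg R ⟶ rightReg R :=
  ModuleCat.ofHom (R := Rᵐᵒᵖ) (X := R) (Y := R)
    { toFun := fun s => r * s
      map_add' := fun a b => mul_add r a b
      map_smul' := fun a b => (mul_assoc r b a.unop).symm }

lemma mulRightHom_one : mulRightHom (1 : R) = 𝟙 _ := by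
  ext; simp [mulRightHom]

lemma mulRightHom_mul (r s : R) : mulRightHom (r * s) = mulRightHom r ≫ mulRightHom s := by
  ext; simp [mulRightHom]

lemma mulRightHom_add (r s : R) : mulRightHom (r + s) = mulRightHom r + mulRightHom s := by
  ext; simp [mulRightHom]

lemma mulLeftHom_one : mulLeftHom (1 : R) = 𝟙 _ := by
  ext; simp [mulLeftHom]

lemma mulLeftHom_mul (r s : R) : mulLeftHom (r * s) = mulLeftHom s ≫ mulLeftHom r := by
  ext; simp [mulLeftHom]

lemma mulLeftHom_add (r s : R) : mulLeftHom (r + s) = mulLeftHom r + mulLeftHom s := by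
  ext; simp [mulLeftHom, add_mul]

/-- For an additive functor `G` on left modules, the group `G(R)` is a right `R`-module:
`x · r = G(· * r)(x)`. -/
abbrev rightModuleAtRing (G : ModuleCat.{u} R ⥤+ AddCommGrpCat.{u}) :
    Module Rᵐᵒᵖ (G.obj.obj (leftReg R)) where
  smul r x := G.obj.map (mulRightHom r.unop) x
  one_smul x := by
    change G.obj.map (mulRightHom 1) x = x
    simp [mulRightHom_one]
  mul_smul r s x := by
    change G.obj.map (mulRightHom (s.unop * r.unop)) x = _
    rw [mulRightHom_mul, Functor.map_comp]; rfl
  smul_zero r := map_zero (G.obj.map (mulRightHom r.unop)).hom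
  smul_add r x y := map_add (G.obj.map (mulRightHom r.unop)).hom x y
  add_smul r s x := by
    change G.obj.map (mulRightHom (r.unop + s.unop)) x = _
    rw [mulRightHom_add, Functor.map_add]; rfl
  zero_smul x := by
    change G.obj.map (mulRightHom 0) x = 0
    have : mulRightHom (0 : R) = 0 := by ext; simp [mulRightHom]
    rw [this, Functor.map_zero]; rfl

/-- The right `R`-module `G(R)`, for an additive functor `G` on left `R`-modules. -/
def evalLeftReg (G : ModuleCat.{u} R ⥤+ AddCommGrpCat.{u}) : ModuleCat.{u} Rᵐᵒᵖ :=
  letI := rightModuleAtRing G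
  ModuleCat.of Rᵐᵒᵖ (G.obj.obj (leftReg R))

/-- For an additive functor `F` on right modules, the group `F(R)` is a left `R`-module:
`r · x = F(r * ·)(x)`. -/
abbrev leftModuleAtRing (F : ModuleCat.{u} Rᵐᵒᵖ ⥤+ AddCommGrpCat.{u}) :
    Module R (F.obj.obj (rightReg R)) where
  smul r x := F.obj.map (mulLeftHom r) x
  one_smul x := by
    change F.obj.map (mulLeftHom 1) x = x
    simp [mulLeftHom_one]
  mul_smul r s x := by
    change F.obj.map (mulLeftHom (r * s)) x = _
    rw [mulLeftHom_mul, Functor.map_comp]; rfl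
  smul_zero r := map_zero (F.obj.map (mulLeftHom r)).hom
  smul_add r x y := map_add (F.obj.map (mulLeftHom r)).hom x y
  add_smul r s x := by
    change F.obj.map (mulLeftHom (r + s)) x = _
    rw [mulLeftHom_add, Functor.map_add]; rfl
  zero_smul x := by
    change F.obj.map (mulLeftHom 0) x = 0
    have : mulLeftHom (0 : R) = 0 := by ext; simp [mulLeftHom]
    rw [this, Functor.map_zero]; rfl

/-- The left `R`-module `F(R)`, for an additive functor `F` on right `R`-modules. -/
def evalRightReg (F : ModuleCat.{u} Rᵐᵒᵖ ⥤+ AddCommGrpCat.{u}) : ModuleCat.{u} R :=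
  letI := leftModuleAtRing F
  ModuleCat.of R (F.obj.obj (rightReg R))

/-- The `R`-linear map `F(R) ⟶ G(R)` given by a natural transformation `F ⟶ G`. -/
def evalRightRegMap {F G : ModuleCat.{u} Rᵐᵒᵖ ⥤+ AddCommGrpCat.{u}} (α : F.obj ⟶ G.obj) :
    evalRightReg F ⟶ evalRightReg G :=
  letI := leftModuleAtRing F
  letI := leftModuleAtRing G
  ModuleCat.ofHom
    { toFun := α.app (rightReg R)
      map_add' := map_add (α.app (rightReg R)).hom
      map_smul' := fun r x => NatTrans.naturality_apply α (mulLeftHom r) x }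

/-- The dual `DF = (L⁰Y)(F)`, where `Y : fp(Mod(R), Ab) ⟶ fp(Mod(Rᵒᵖ), Ab)` is the contravariant
functor `Y(F) = (F(R), -)`, computed from the beginning `0 ⟶ F ⟶ I₀ ⟶ I₁` of an injective
resolution of `F` in `fp(Mod(R), Ab)`: it is the cokernel of `Y(I₁) ⟶ Y(I₀)`. -/
def InjectiveCopresentation.dual {F : FP (ModuleCat.{u} Rᵐᵒᵖ)}
    (I : InjectiveCopresentation F) : FP (ModuleCat.{u} R) :=
  FP.coker (evalRightRegMap (FP.nat I.d))

/-! ### Tensor products over a noncommutative ring and `Tor` -/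

/-- The subgroup of `A ⊗[ℤ] M` generated by the elements `(a · r) ⊗ m - a ⊗ (r · m)`. -/
def balancing (A : ModuleCat.{u} Rᵐᵒᵖ) (M : ModuleCat.{u} R) : AddSubgroup (A ⊗[ℤ] M) :=
  AddSubgroup.closure
    {x | ∃ (a : A) (r : R) (m : M), x = (MulOpposite.op r • a) ⊗ₜ[ℤ] m - a ⊗ₜ[ℤ] (r • m)}

lemma balancing_le_comap {A B : ModuleCat.{u} Rᵐᵒᵖ} (M : ModuleCat.{u} R) (f : A ⟶ B) :
    balancing A M ≤
      (balancing B M).comap (f.hom.toAddMonoidHom.toIntLinearMap.rTensor M).toAddMonoidHom := by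
  rw [balancing, AddSubgroup.closure_le]
  rintro _ ⟨a, r, m, rfl⟩
  refine AddSubgroup.subset_closure ⟨f.hom a, r, m, ?_⟩
  simp

/-- The additive functor `- ⊗_R M` from right `R`-modules to abelian groups. -/
def tensorFunctor (M : ModuleCat.{u} R) : ModuleCat.{u} Rᵐᵒᵖ ⥤ AddCommGrpCat.{u} where
  obj A := AddCommGrpCat.of ((A ⊗[ℤ] M) ⧸ balancing A M)
  map f := AddCommGrpCat.ofHom (QuotientAddGroup.map _ _ _ (balancing_le_comap M f))
  map_id A := by
    ext x
    induction x using TensorProduct.induction_on with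
    | zero => exact map_zero _
    | tmul a m => rfl
    | add x y hx hy =>
      exact (map_add _ x y).trans
        ((congrArg₂ (· + ·) hx hy).trans (map_add _ _ _).symm)
  map_comp {A B C} f g := by
    ext x
    induction x using TensorProduct.induction_on with
    | zero => exact (map_zero _).trans (map_zero _).symm
    | tmul a m => rfl
    | add x y hx hy =>
      exact (map_add _ x y).trans
        ((congrArg₂ (· + ·) hx hy).trans (map_add _ _ _).symm)

instance (M : ModuleCat.{u} R) : (tensorFunctor M).Additive where
  map_add {A B f g} := by
    ext x
    induction x using QuotientAddGroup.induction_on with | H x => ?_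
    induction x using TensorProduct.induction_on with
    | zero => exact (map_zero _).trans (map_zero _).symm
    | tmul a m =>
      exact congrArg (QuotientAddGroup.mk' (balancing B M))
        (TensorProduct.add_tmul (f.hom a) (g.hom a) m)
    | add x y hx hy =>
      exact (map_add _ (x : (A ⊗[ℤ] M) ⧸ balancing A M) y).trans
        ((congrArg₂ (· + ·) hx hy).trans (map_add _ _ _).symm)

/-- The functor `Torₙ(-, M)` from right `R`-modules to abelian groups. -/
def torFunctor (n : ℕ) (M : ModuleCat.{u} R) : ModuleCat.{u} Rᵐᵒᵖ ⥤ AddCommGrpCat.{u} :=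
  (tensorFunctor M).leftDerived n

/-- The functor `Extⁿ(M, -)` from left `R`-modules to abelian groups. -/
def extFunctor (n : ℕ) (M : ModuleCat.{u} R) : ModuleCat.{u} R ⥤+ AddCommGrpCat.{u} :=
  AdditiveFunctor.of (Abelian.extFunctorObj M n)

end Modules

end FunctorDefect

end

/-! A single map `g : V₀ ⟶ V₁` of finitely presented left modules controls both sides. It determines
the functor F = ker(- ⊗ g) on right modules (`IsTensorKernel`) and the functor G = coker((V₁, -) ⟶
(V₀, -)) on left modules (`IsPresentedBy`). The claim is that w(F) ≅ G(R) for every such pair, and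
that all the pairs in the theorem, (SₙF, Sⁿ(DF)) and (Torₙ(-, M), Extⁿ(M, -)), arise in this way.

The isomorphism w(F) ≅ G(R) (`Presentation.nonempty_defect_iso`): since A ⊗ R ≅ A, the Yoneda lemma
identifies Nat(F, - ⊗ R) with ker(X ⟶ Y) = w(F). The functor - ⊗ R is right exact and finitely
presented, hence injective in fp(Mod(R), Ab) (`FP.injective_of_isRightExact`). So Nat(-, - ⊗ R)
turns 0 ⟶ F ⟶ - ⊗ V₀ ⟶ - ⊗ V₁ into a right exact sequence V₁* ⟶ V₀* ⟶ w(F) ⟶ 0 of right modules,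
where V* = Hom(V, R). The cokernel of V₁* ⟶ V₀* is G(R).

Part (1): coherence on the right embeds a totally finitely presented F into some - ⊗ V₀, and the
cokernel into some - ⊗ V₁, so F = ker(- ⊗ g) (`exists_isTensorKernel`). This is an injective
copresentation. Any other one is homotopy equivalent to it, and R ⊗ V ≅ V, so DF is the cokernel of
(g, -) for every choice (`InjectiveCopresentation.isPresentedBy_dual`). Next, cover V₀ and V₁ by
free modules L₀ and L₁ so that g lifts to a split monomorphism L₀ ⟶ L₁, and let `k : K₀ ⟶ K₁` be the
map of kernels. Snake arguments show that k plays for S₁F and S¹G the role that g plays for F and G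
(`exists_satellite_step`). Coherence on the left keeps K₀ and K₁ finitely presented, so the step can
be iterated.

Part (2): Tor₀ and Ext⁰ correspond to the zero map M ⟶ M, Tor₁ and Ext¹ to the inclusion of a syzygy
K ⟶ L, and dimension shifting reduces higher degrees to these (`exists_tor_ext`). -/

noncomputable section

namespace FunctorDefect

/-! ### Tensor functors over a noncommutative ring and their natural transformations -/

section Tensor

variable {R : Type u} [Ring R]

/-- The projection of `A ⊗_ℤ M` onto `A ⊗_R M`. -/
def tensorMk (M : ModuleCat.{u} R) (A : ModuleCat.{u} Rᵐᵒᵖ) :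
    A ⊗[ℤ] M →+ (tensorFunctor M).obj A :=
  QuotientAddGroup.mk' (balancing A M)

lemma tensorMk_surjective (M : ModuleCat.{u} R) (A : ModuleCat.{u} Rᵐᵒᵖ) :
    Function.Surjective (tensorMk M A) :=
  QuotientAddGroup.mk'_surjective (balancing A M)

lemma tensorMk_eq_zero_iff {M : ModuleCat.{u} R} {A : ModuleCat.{u} Rᵐᵒᵖ} {t : A ⊗[ℤ] M} :
    tensorMk M A t = 0 ↔ t ∈ balancing A M :=
  QuotientAddGroup.eq_zero_iff t

/-- The class of the pure tensor `a ⊗ m` in `A ⊗_R M`. -/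
def pureTensor (M : ModuleCat.{u} R) (A : ModuleCat.{u} Rᵐᵒᵖ) :
    A →+ M →+ (tensorFunctor M).obj A :=
  AddMonoidHom.mk' (fun a => AddMonoidHom.mk' (fun m => tensorMk M A (a ⊗ₜ[ℤ] m))
    (fun m m' => by rw [TensorProduct.tmul_add, map_add]))
    (fun a a' => by
      ext m
      change tensorMk M A _ = tensorMk M A _ + tensorMk M A _
      rw [TensorProduct.add_tmul, map_add])

-- No separate case for zero is needed, because zero is the pure tensor of zeros.
@[elab_as_elim]
lemma tensor_induction {M : ModuleCat.{u} R} {A : ModuleCat.{u} Rᵐᵒᵖ}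
    {motive : (tensorFunctor M).obj A → Prop} (x : (tensorFunctor M).obj A)
    (pure : ∀ a m, motive (pureTensor M A a m))
    (add : ∀ x y, motive x → motive y → motive (x + y)) : motive x := by
  obtain ⟨t, rfl⟩ := tensorMk_surjective M A x
  induction t using TensorProduct.induction_on with
  | zero =>
    rw [map_zero, ← map_zero (pureTensor M A 0)]
    exact pure 0 0
  | tmul a m => exact pure a m
  | add x y hx hy =>
    rw [map_add]
    exact add _ _ hx hy

lemma pureTensor_smul {M : ModuleCat.{u} R} {A : ModuleCat.{u} Rᵐᵒᵖ} (a : A) (r : R) (m : M) :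
    pureTensor M A (MulOpposite.op r • a) m = pureTensor M A a (r • m) := by
  refine (QuotientAddGroup.eq_iff_sub_mem).2 ?_
  exact AddSubgroup.subset_closure ⟨a, r, m, rfl⟩

@[simp]
lemma tensorFunctor_map_pure {M : ModuleCat.{u} R} {A B : ModuleCat.{u} Rᵐᵒᵖ} (f : A ⟶ B)
    (a : A) (m : M) : (tensorFunctor M).map f (pureTensor M A a m) = pureTensor M B (f a) m :=
  rfl

/-- The homomorphism out of `A ⊗_R M` given by a balanced biadditive map. -/
def tensorLift {M : ModuleCat.{u} R} {A : ModuleCat.{u} Rᵐᵒᵖ} {B : Type*} [AddCommGroup B]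
    (β : A →+ M →+ B) (h : ∀ a (r : R) m, β (MulOpposite.op r • a) m = β a (r • m)) :
    (tensorFunctor M).obj A →+ B :=
  QuotientAddGroup.lift (balancing A M)
    (TensorProduct.liftAddHom β (fun r a m => by simp)) (by
      rw [balancing, AddSubgroup.closure_le]
      rintro _ ⟨a, r, m, rfl⟩
      simp [h])

/-- The homomorphism `A ⊗_R M ⟶ A ⊗_R N` given by a linear map `M ⟶ N`. -/
def tensorMapHom {M N : ModuleCat.{u} R} (g : M ⟶ N) (A : ModuleCat.{u} Rᵐᵒᵖ) :
    (tensorFunctor M).obj A →+ (tensorFunctor N).obj A :=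
  tensorLift (AddMonoidHom.mk' (fun a => (pureTensor N A a).comp g.hom.toAddMonoidHom)
      (fun a b => by rw [map_add]; rfl))
    (fun a r m => (pureTensor_smul a r (g m)).trans
      (congrArg (pureTensor N A a) (g.hom.map_smul r m).symm))

/-- The natural transformation `- ⊗_R M ⟶ - ⊗_R N` given by a linear map `M ⟶ N`. -/
def tensorMap {M N : ModuleCat.{u} R} (g : M ⟶ N) : tensorFunctor M ⟶ tensorFunctor N where
  app A := AddCommGrpCat.ofHom (tensorMapHom g A)
  naturality A B f := by
    ext x
    induction x using tensor_induction with
    | pure a m => rfl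
    | add x y hx hy => rw [map_add, hx, hy, map_add]

@[simp]
lemma tensorMap_pure {M N : ModuleCat.{u} R} (g : M ⟶ N) {A : ModuleCat.{u} Rᵐᵒᵖ} (a : A)
    (m : M) : (tensorMap g).app A (pureTensor M A a m) = pureTensor N A a (g m) :=
  rfl

lemma tensorFunctor_hom_ext {M : ModuleCat.{u} R} {G : ModuleCat.{u} Rᵐᵒᵖ ⥤ AddCommGrpCat.{u}}
    {φ ψ : tensorFunctor M ⟶ G}
    (h : ∀ A a m, φ.app A (pureTensor M A a m) = ψ.app A (pureTensor M A a m)) : φ = ψ := by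
  ext A x
  induction x using tensor_induction with
  | pure a m => exact h A a m
  | add x y hx hy => rw [map_add, hx, hy, map_add]

@[simp]
lemma tensorMap_id (M : ModuleCat.{u} R) : tensorMap (𝟙 M) = 𝟙 _ :=
  tensorFunctor_hom_ext fun _ _ _ => rfl

@[simp]
lemma tensorMap_comp {M N K : ModuleCat.{u} R} (f : M ⟶ N) (g : N ⟶ K) :
    tensorMap (f ≫ g) = tensorMap f ≫ tensorMap g :=
  tensorFunctor_hom_ext fun _ _ _ => rfl

lemma tensorMap_zero (M N : ModuleCat.{u} R) : tensorMap (0 : M ⟶ N) = 0 :=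
  tensorFunctor_hom_ext fun A a _ => map_zero (pureTensor N A a)

/-! ### Right exactness -/

lemma tensorFunctor_map_surjective (M : ModuleCat.{u} R) {A B : ModuleCat.{u} Rᵐᵒᵖ} (f : A ⟶ B)
    (hf : Function.Surjective f) : Function.Surjective ((tensorFunctor M).map f) := by
  intro x
  induction x using tensor_induction with
  | pure b m =>
    obtain ⟨a, rfl⟩ := hf b
    exact ⟨pureTensor M A a m, rfl⟩
  | add x y hx hy =>
    obtain ⟨x', rfl⟩ := hx
    obtain ⟨y', rfl⟩ := hy
    exact ⟨x' + y', map_add _ _ _⟩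

lemma tensorMap_surjective {M N : ModuleCat.{u} R} (g : M ⟶ N) (hg : Function.Surjective g)
    (A : ModuleCat.{u} Rᵐᵒᵖ) : Function.Surjective ((tensorMap g).app A) := by
  intro x
  induction x using tensor_induction with
  | pure a n =>
    obtain ⟨m, rfl⟩ := hg n
    exact ⟨pureTensor M A a m, rfl⟩
  | add x y hx hy =>
    obtain ⟨x', rfl⟩ := hx
    obtain ⟨y', rfl⟩ := hy
    exact ⟨x' + y', map_add _ _ _⟩

lemma tensorFunctor_map_mk (M : ModuleCat.{u} R) {A B : ModuleCat.{u} Rᵐᵒᵖ} (f : A ⟶ B)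
    (t : A ⊗[ℤ] M) : (tensorFunctor M).map f (tensorMk M A t) =
      tensorMk M B (f.hom.toAddMonoidHom.toIntLinearMap.rTensor M t) :=
  rfl

lemma tensorMap_mk {M N : ModuleCat.{u} R} (g : M ⟶ N) {A : ModuleCat.{u} Rᵐᵒᵖ}
    (t : A ⊗[ℤ] M) : (tensorMap g).app A (tensorMk M A t) =
      tensorMk N A (g.hom.toAddMonoidHom.toIntLinearMap.lTensor A t) := by
  induction t using TensorProduct.induction_on with
  | zero => simp only [map_zero]
  | tmul a m => rfl
  | add x y hx hy => rw [map_add, map_add, hx, hy, map_add, map_add]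

/-- Right exactness over ℤ descends to R because `g` is surjective: every balancing relation over C
lifts to one over B, so an element killed over R can be corrected by a balancing element to one
killed over ℤ. -/
lemma tensorFunctor_map_exact (M : ModuleCat.{u} R) {A B C : ModuleCat.{u} Rᵐᵒᵖ} (f : A ⟶ B)
    (g : B ⟶ C) (hfg : Function.Exact f g) (hg : Function.Surjective g) :
    Function.Exact ((tensorFunctor M).map f) ((tensorFunctor M).map g) := by
  intro x
  constructor
  · intro hx
    obtain ⟨t, rfl⟩ := tensorMk_surjective M B x
    rw [tensorFunctor_map_mk, tensorMk_eq_zero_iff] at hx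
    have hle : balancing C M ≤ (balancing B M).map
        (g.hom.toAddMonoidHom.toIntLinearMap.rTensor M).toAddMonoidHom := by
      rw [balancing, AddSubgroup.closure_le]
      rintro _ ⟨c, r, m, rfl⟩
      obtain ⟨b, rfl⟩ := hg c
      exact ⟨_, AddSubgroup.subset_closure ⟨b, r, m, rfl⟩, by simp⟩
    obtain ⟨s, hs, hst⟩ := hle hx
    obtain ⟨w, hw⟩ := (rTensor_exact (R := ℤ) (f := f.hom.toAddMonoidHom.toIntLinearMap)
      (g := g.hom.toAddMonoidHom.toIntLinearMap) M hfg hg (t - s)).1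
      (by rw [map_sub, sub_eq_zero]; exact hst.symm)
    refine ⟨tensorMk M A w, ?_⟩
    rw [tensorFunctor_map_mk, hw, map_sub, sub_eq_self]
    exact tensorMk_eq_zero_iff.2 hs
  · rintro ⟨y, rfl⟩
    induction y using tensor_induction with
    | pure a m =>
      rw [tensorFunctor_map_pure, tensorFunctor_map_pure, hfg.apply_apply_eq_zero]
      simp
    | add x y hx hy => rw [map_add, map_add, hx, hy, add_zero]

/-- The same correction as in the other variable: balancing relations lift along the surjection `g`.
-/
lemma tensorMap_exact {M N K : ModuleCat.{u} R} (f : M ⟶ N) (g : N ⟶ K)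
    (hfg : Function.Exact f g) (hg : Function.Surjective g) (A : ModuleCat.{u} Rᵐᵒᵖ) :
    Function.Exact ((tensorMap f).app A) ((tensorMap g).app A) := by
  intro x
  constructor
  · intro hx
    obtain ⟨t, rfl⟩ := tensorMk_surjective N A x
    rw [tensorMap_mk, tensorMk_eq_zero_iff] at hx
    have hle : balancing A K ≤ (balancing A N).map
        (g.hom.toAddMonoidHom.toIntLinearMap.lTensor A).toAddMonoidHom := by
      rw [balancing, AddSubgroup.closure_le]
      rintro _ ⟨a, r, k, rfl⟩
      obtain ⟨n, rfl⟩ := hg k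
      exact ⟨_, AddSubgroup.subset_closure ⟨a, r, n, rfl⟩, by simp⟩
    obtain ⟨s, hs, hst⟩ := hle hx
    obtain ⟨w, hw⟩ := (lTensor_exact (R := ℤ) (f := f.hom.toAddMonoidHom.toIntLinearMap)
      (g := g.hom.toAddMonoidHom.toIntLinearMap) A hfg hg (t - s)).1
      (by rw [map_sub, sub_eq_zero]; exact hst.symm)
    refine ⟨tensorMk M A w, ?_⟩
    rw [tensorMap_mk, hw, map_sub, sub_eq_self]
    exact tensorMk_eq_zero_iff.2 hs
  · rintro ⟨y, rfl⟩
    induction y using tensor_induction with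
    | pure a m => rw [tensorMap_pure, tensorMap_pure, hfg.apply_apply_eq_zero, map_zero]
    | add x y hx hy => rw [map_add, map_add, hx, hy, add_zero]

/-! ### Tensoring with the regular module -/

/-- The multiplication `A ⊗_R R ⟶ A`. -/
def tensorRegularHom (A : ModuleCat.{u} Rᵐᵒᵖ) : (tensorFunctor (leftReg R)).obj A →+ A :=
  tensorLift (M := leftReg R)
    (AddMonoidHom.mk' (fun a => AddMonoidHom.mk' (fun r : R => MulOpposite.op r • a)
      (fun r s => by simp [add_smul])) (fun a b => by ext; simp))
    (fun a r m => (mul_smul (MulOpposite.op (m : R)) (MulOpposite.op r) a).symm)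

lemma pureTensor_tensorRegularHom {A : ModuleCat.{u} Rᵐᵒᵖ}
    (x : (tensorFunctor (leftReg R)).obj A) :
    pureTensor (leftReg R) A (tensorRegularHom A x) (1 : R) = x := by
  induction x using tensor_induction with
  | pure a m =>
    exact (pureTensor_smul (M := leftReg R) a m (1 : R)).trans
      (congrArg (pureTensor (leftReg R) A a) (mul_one (m : R)))
  | add x y hx hy => rw [map_add, map_add, AddMonoidHom.add_apply, hx, hy]

/-- The isomorphism `A ⊗_R R ≅ A`. -/
def tensorRegular (A : ModuleCat.{u} Rᵐᵒᵖ) : (tensorFunctor (leftReg R)).obj A ≃+ A where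
  __ := tensorRegularHom A
  invFun a := pureTensor (leftReg R) A a (1 : R)
  left_inv := pureTensor_tensorRegularHom
  right_inv a := one_smul Rᵐᵒᵖ a

lemma tensorRegular_naturality {A B : ModuleCat.{u} Rᵐᵒᵖ} (f : A ⟶ B)
    (x : (tensorFunctor (leftReg R)).obj A) :
    tensorRegular B ((tensorFunctor (leftReg R)).map f x) = f (tensorRegular A x) := by
  induction x using tensor_induction with
  | pure a m => exact (f.hom.map_smul _ _).symm
  | add x y hx hy => rw [map_add, map_add, hx, hy, map_add, map_add]

/-- The isomorphism `R ⊗_R M ≅ M` of left modules. -/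
def evalTensor (M : ModuleCat.{u} R) :
    evalRightReg (AdditiveFunctor.of (tensorFunctor M)) ≅ M := by
  letI := leftModuleAtRing (AdditiveFunctor.of (tensorFunctor M))
  let φ : (tensorFunctor M).obj (rightReg R) →+ M :=
    tensorLift (A := rightReg R)
      (AddMonoidHom.mk' (fun a : R => AddMonoidHom.mk' (fun m : M => a • m)
      (fun m n => smul_add a m n)) (fun a b => by ext; simp [add_smul]))
      (fun a r m => mul_smul (a : R) r m)
  have hφ : ∀ x, pureTensor M (rightReg R) (1 : R) (φ x) = x := fun x => by
    induction x using tensor_induction with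
    | pure a m => exact (pureTensor_smul (A := rightReg R) (1 : R) a m).symm.trans (by simp)
    | add x y hx hy => rw [map_add, map_add, hx, hy]
  let e : evalRightReg (AdditiveFunctor.of (tensorFunctor M)) →ₗ[R] M :=
    { toFun := φ
      map_add' := map_add φ
      map_smul' := fun r x => by
        change φ ((tensorFunctor M).map (mulLeftHom r) x) = r • φ x
        induction x using tensor_induction with
        | pure a m => exact mul_smul r (a : R) m
        | add x y hx hy => rw [map_add, map_add, hx, hy, map_add, smul_add] }
  exact (LinearEquiv.ofBijective e ⟨fun x y h => by rw [← hφ x, ← hφ y]; exact congrArg _ h,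
    fun m => ⟨pureTensor M (rightReg R) (1 : R) m, one_smul R m⟩⟩).toModuleIso

lemma evalTensor_pure (M : ModuleCat.{u} R) (a : R) (m : M) :
    (evalTensor M).hom (pureTensor M (rightReg R) a m) = a • m :=
  rfl

lemma evalTensor_inv (M : ModuleCat.{u} R) (m : M) :
    (evalTensor M).inv m = pureTensor M (rightReg R) (1 : R) m := by
  have := evalTensor_pure M 1 m
  rw [one_smul] at this
  conv_lhs => rw [← this]
  exact (evalTensor M).hom_inv_id_apply _

lemma evalTensor_naturality {M N : ModuleCat.{u} R} (g : M ⟶ N) :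
    evalRightRegMap (F := AdditiveFunctor.of (tensorFunctor M))
      (G := AdditiveFunctor.of (tensorFunctor N)) (tensorMap g) ≫ (evalTensor N).hom =
      (evalTensor M).hom ≫ g := by
  ext (x : (tensorFunctor M).obj (rightReg R))
  induction x using tensor_induction with
  | pure a m => exact (g.hom.map_smul (a : R) m).symm
  | add x y hx hy => exact (map_add _ x y).trans ((congrArg₂ _ hx hy).trans (map_add _ x y).symm)

/-- The homomorphism of right modules `R ⟶ A` with value `a` at `1`. -/
def elementHom {A : ModuleCat.{u} Rᵐᵒᵖ} (a : A) : rightReg R ⟶ A :=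
  ModuleCat.ofHom (R := Rᵐᵒᵖ) (X := R)
    { toFun := fun r => MulOpposite.op r • a
      map_add' := fun r s => by simp [add_smul]
      map_smul' := fun r s => mul_smul r (MulOpposite.op s) a }

lemma elementHom_one {A : ModuleCat.{u} Rᵐᵒᵖ} (a : A) : elementHom a (1 : R) = a :=
  one_smul Rᵐᵒᵖ a

/-- Every natural transformation between tensor functors is induced by a linear map. -/
lemma exists_tensorMap_eq {M N : ModuleCat.{u} R} (τ : tensorFunctor M ⟶ tensorFunctor N) :
    ∃ g : M ⟶ N, tensorMap g = τ := by
  refine ⟨(evalTensor M).inv ≫ evalRightRegMap (F := AdditiveFunctor.of (tensorFunctor M))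
      (G := AdditiveFunctor.of (tensorFunctor N)) τ ≫ (evalTensor N).hom, ?_⟩
  refine tensorFunctor_hom_ext fun A a m => ?_
  -- The map R ⟶ A sending 1 to a carries 1 ⊗ m to a ⊗ m, so naturality determines τ by its
  -- component at R.
  have h (y : (tensorFunctor N).obj (rightReg R)) :
      pureTensor N A a ((evalTensor N).hom y) = (tensorFunctor N).map (elementHom a) y := by
    induction y using tensor_induction with
    | pure r n => exact (pureTensor_smul a (r : R) n).symm
    | add x y hx hy =>
      exact (congrArg _ (map_add (evalTensor N).hom.hom x y)).trans
        ((map_add _ _ _).trans ((congrArg₂ _ hx hy).trans (map_add _ x y).symm))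
  refine (h _).trans ?_
  refine (NatTrans.naturality_apply τ (elementHom a) _).symm.trans ?_
  refine congrArg (τ.app A) ((congrArg _ (evalTensor_inv M m)).trans ?_)
  exact congrArg (fun b => pureTensor M A b m) (elementHom_one a)

lemma tensorMap_injective {M N : ModuleCat.{u} R} {g g' : M ⟶ N}
    (h : tensorMap g = tensorMap g') : g = g' := by
  rw [← Iso.cancel_iso_hom_left (evalTensor M), ← evalTensor_naturality, h, evalTensor_naturality]

end Tensor

/-! ### Natural transformations defined by relations on elements -/

section Relations

variable {C : Type u} [Category.{v} C]

/-- A natural relation between two functors to abelian groups which is closed under subtraction,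
total and single-valued is the graph of a natural transformation. -/
theorem exists_natTrans_of_relation {F G : C ⥤ AddCommGrpCat.{v}}
    (r : ∀ A, F.obj A → G.obj A → Prop)
    (r_sub : ∀ A x x' y y', r A x y → r A x' y' → r A (x - x') (y - y'))
    (r_total : ∀ A x, ∃ y, r A x y) (r_zero : ∀ A y, r A 0 y → y = 0)
    (r_map : ∀ A B (f : A ⟶ B) x y, r A x y → r B (F.map f x) (G.map f y)) :
    ∃ τ : F ⟶ G, ∀ A x, r A x (τ.app A x) := by
  choose t ht using r_total
  have uniq (A x y) (h : r A x y) : y = t A x := by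
    have := r_sub _ _ _ _ _ h (ht A x)
    rw [sub_self] at this
    exact sub_eq_zero.1 (r_zero _ _ this)
  have h0 (A) : r A 0 0 := by simpa using r_sub _ _ _ _ _ (ht A 0) (ht A 0)
  have r_add (A x x' y y') (h : r A x y) (h' : r A x' y') : r A (x + x') (y + y') := by
    simpa using r_sub _ _ _ _ _ h (r_sub _ _ _ _ _ (h0 A) h')
  refine ⟨{ app := fun A => AddCommGrpCat.ofHom (AddMonoidHom.mk' (t A)
              (fun x y => (uniq _ _ _ (r_add _ _ _ _ _ (ht A x) (ht A y))).symm))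
            naturality := fun A B f => ?_ }, fun A x => ht A x⟩
  ext x
  exact (uniq _ _ _ (r_map _ _ f _ _ (ht A x))).symm

lemma map_map_apply (F : C ⥤ AddCommGrpCat.{v}) {X Y Z : C} (f : X ⟶ Y) (g : Y ⟶ Z)
    (x : F.obj X) : F.map g (F.map f x) = F.map (f ≫ g) x :=
  (congrArg (fun h => h x) (F.map_comp f g)).symm

lemma map_id_apply (F : C ⥤ AddCommGrpCat.{v}) {X : C} (x : F.obj X) : F.map (𝟙 X) x = x :=
  congrArg (fun h => h x) (F.map_id X)

end Relations

/-! ### Finitely presented functors by generator and universal relation -/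

section General

variable {C : Type u} [Category.{v} C] [Abelian C]

/-- The natural transformation `(X, -) ⟶ G` given by an element of `G(X)`. -/
def coyonedaHom (G : C ⥤ AddCommGrpCat.{v}) [G.Additive] {X : C} (x : G.obj X) :
    preadditiveCoyoneda.obj (op X) ⟶ G where
  app A := AddCommGrpCat.ofHom (AddMonoidHom.mk' (fun f : X ⟶ A => G.map f x)
    (fun f g => congrArg (fun h => h x) (G.map_add (f := (f : X ⟶ A)) (g := (g : X ⟶ A)))))
  naturality A B f := by
    ext (g : X ⟶ A)
    exact congrArg (fun h => h x) (G.map_comp g f)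

lemma coyoneda_app {G : C ⥤ AddCommGrpCat.{v}} {X A : C}
    (τ : preadditiveCoyoneda.obj (op X) ⟶ G) (f : X ⟶ A) :
    τ.app A f = G.map f (τ.app X (𝟙 X)) :=
  (congrArg (τ.app A) (Category.id_comp f).symm).trans (NatTrans.naturality_apply τ f (𝟙 X))

lemma map_zero_apply (F : C ⥤ AddCommGrpCat.{v}) [F.Additive] {X Y : C} (x : F.obj X) :
    F.map (0 : X ⟶ Y) x = 0 :=
  congrArg (fun h => h x) (F.map_zero X Y)

namespace Presentation

variable {F : C ⥤ AddCommGrpCat.{v}} (P : Presentation F)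

/-- The generator of a finitely presented functor. -/
def gen : F.obj P.X := P.π.app P.X (𝟙 P.X)

lemma exists_map_gen {A : C} (x : F.obj A) : ∃ f : P.X ⟶ A, F.map f P.gen = x := by
  obtain ⟨f, rfl⟩ := P.surjective A x
  exact ⟨f, (coyoneda_app P.π f).symm⟩

/-- Exactness of the presentation at (X, -), read through the Yoneda lemma: `P.f` is the universal
relation on the generator. Together with `exists_map_gen` this captures the whole presentation. -/
lemma map_gen_eq_zero_iff {A : C} (f : P.X ⟶ A) :
    F.map f P.gen = 0 ↔ ∃ y : P.Y ⟶ A, P.f ≫ y = f := by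
  rw [gen, ← coyoneda_app P.π f]
  exact P.exact A f

lemma map_f_gen : F.map P.f P.gen = 0 :=
  (P.map_gen_eq_zero_iff _).2 ⟨𝟙 _, Category.comp_id _⟩

lemma additive {F : C ⥤ AddCommGrpCat.{v}} (P : Presentation F) : F.Additive :=
  additive_of_surjective P.π P.surjective

/-- A presentation is given by a generator and a universal relation. -/
def ofGen [F.Additive] {X Y : C} (f : X ⟶ Y) (x : F.obj X)
    (h : ∀ (A : C) (a : F.obj A), ∃ g : X ⟶ A, F.map g x = a)
    (h' : ∀ (A : C) (g : X ⟶ A), F.map g x = 0 ↔ ∃ y : Y ⟶ A, f ≫ y = g) : Presentation F where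
  X := X
  Y := Y
  f := f
  π := coyonedaHom F x
  exact A g := h' A g
  surjective A a := h A a

lemma hom_ext {G : C ⥤ AddCommGrpCat.{v}} {τ τ' : F ⟶ G}
    (h : τ.app _ P.gen = τ'.app _ P.gen) : τ = τ' := by
  ext A x
  obtain ⟨f, rfl⟩ := P.exists_map_gen x
  exact (NatTrans.naturality_apply τ f _).trans
    ((congrArg _ h).trans (NatTrans.naturality_apply τ' f _).symm)

/-- With `hom_ext` this is the identification of Nat(F, G) with ker(G(X) ⟶ G(Y)). The transformation
is built from the relation between F(f)(gen) and G(f)(y), which is single-valued because `y` is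
killed by the universal relation. -/
lemma exists_desc {G : C ⥤ AddCommGrpCat.{v}} [G.Additive] (y : G.obj P.X)
    (hy : G.map P.f y = 0) : ∃ τ : F ⟶ G, τ.app _ P.gen = y := by
  have := P.additive
  have h_sub (A) (x x' : F.obj A) (z z' : G.obj A) :
      (∃ f : P.X ⟶ A, F.map f P.gen = x ∧ G.map f y = z) →
      (∃ f : P.X ⟶ A, F.map f P.gen = x' ∧ G.map f y = z') →
      ∃ f : P.X ⟶ A, F.map f P.gen = x - x' ∧ G.map f y = z - z' := by
    rintro ⟨f, rfl, rfl⟩ ⟨f', rfl, rfl⟩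
    exact ⟨f - f', by rw [F.map_sub]; rfl, by rw [G.map_sub]; rfl⟩
  have h_total (A) (x : F.obj A) :
      ∃ z, ∃ f : P.X ⟶ A, F.map f P.gen = x ∧ G.map f y = z := by
    obtain ⟨f, rfl⟩ := P.exists_map_gen x
    exact ⟨_, f, rfl, rfl⟩
  have h_zero (A) (z : G.obj A) :
      (∃ f : P.X ⟶ A, F.map f P.gen = 0 ∧ G.map f y = z) → z = 0 := by
    rintro ⟨f, h1, rfl⟩
    obtain ⟨g, rfl⟩ := (P.map_gen_eq_zero_iff _).1 h1
    rw [G.map_comp]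
    exact (congrArg (G.map g) hy).trans (map_zero _)
  have h_map (A B) (g : A ⟶ B) (x : F.obj A) (z : G.obj A) :
      (∃ f : P.X ⟶ A, F.map f P.gen = x ∧ G.map f y = z) →
      ∃ f : P.X ⟶ B, F.map f P.gen = F.map g x ∧ G.map f y = G.map g z := by
    rintro ⟨f, rfl, rfl⟩
    exact ⟨f ≫ g, by rw [F.map_comp]; rfl, by rw [G.map_comp]; rfl⟩
  obtain ⟨τ, hτ⟩ := exists_natTrans_of_relation (F := F) (G := G) _ h_sub h_total h_zero h_map
  obtain ⟨f, h1, h2⟩ := hτ _ P.gen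
  refine ⟨τ, ?_⟩
  have : F.map (f - 𝟙 _) P.gen = 0 := by
    rw [F.map_sub]
    refine sub_eq_zero.2 (h1.trans ?_)
    rw [F.map_id]; rfl
  obtain ⟨g, hg⟩ := (P.map_gen_eq_zero_iff _).1 this
  have hf : f = P.f ≫ g + 𝟙 _ := by rw [hg, sub_add_cancel]
  rw [← h2, hf, G.map_add, G.map_comp, G.map_id]
  refine (congrArg (fun z => G.map g z + y) hy).trans ?_
  rw [map_zero, zero_add]

end Presentation

lemma exists_coker_gen {X Y : C} (f : X ⟶ Y) : ∃ x : (coker f).obj X,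
    (∀ (A : C) (a : (coker f).obj A), ∃ g : X ⟶ A, (coker f).map g x = a) ∧
    ∀ (A : C) (g : X ⟶ A), (coker f).map g x = 0 ↔ ∃ y : Y ⟶ A, f ≫ y = g :=
  ⟨(cokerPresentation f).gen, fun _ a => (cokerPresentation f).exists_map_gen a,
    fun _ g => (cokerPresentation f).map_gen_eq_zero_iff g⟩

/-- A kernel of a morphism of finitely presented functors is finitely presented. -/
theorem nonempty_presentation_of_exact {F T T' : C ⥤ AddCommGrpCat.{v}} (P : Presentation T)
    (P' : Presentation T') (ι : F ⟶ T) (d : T ⟶ T') (hι : ∀ A, Function.Injective (ι.app A))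
    (h : ∀ A, Function.Exact (ι.app A) (d.app A)) : Nonempty (Presentation F) := by
  have := P.additive
  have := P'.additive
  have : F.Additive := ⟨fun {A B f g} => by
    have : Mono (ι.app B) := (AddCommGrpCat.mono_iff_injective _).2 (hι B)
    rw [← cancel_mono (ι.app B)]
    simp only [Preadditive.add_comp, NatTrans.naturality, Functor.map_add,
      Preadditive.comp_add]⟩
  obtain ⟨a, ha⟩ := P'.exists_map_gen (d.app _ P.gen)
  have hd {A : C} (f : P.X ⟶ A) : d.app A (T.map f P.gen) = T'.map (a ≫ f) P'.gen := by
    rw [T'.map_comp]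
    exact (NatTrans.naturality_apply d f _).trans (congrArg (T'.map f) ha.symm)
  -- A map out of this pushout is a map f out of `P.X` with a witness that `a ≫ f` factors through
  -- `P'.f`, that is, with a proof that f represents an element of ker d. Hence the left leg
  -- represents the generator of F.
  obtain ⟨w, hw⟩ := (h _ (T.map (pushout.inl a P'.f) P.gen)).1 (by
    rw [hd, P'.map_gen_eq_zero_iff]
    exact ⟨_, pushout.condition.symm⟩)
  have hF {A : C} (e : pushout a P'.f ⟶ A) :
      ι.app A (F.map e w) = T.map (pushout.inl a P'.f ≫ e) P.gen := by
    rw [T.map_comp]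
    exact (NatTrans.naturality_apply ι e _).trans (congrArg (T.map e) hw)
  -- The generator dies under e exactly when the left component of e factors through `P.f`.
  -- Replacing the corner `P.X` of the pushout by `P.Y` encodes this condition.
  refine ⟨Presentation.ofGen (F := F)
    (pushout.desc (P.f ≫ pushout.inl (a ≫ P.f) P'.f) (pushout.inr (a ≫ P.f) P'.f)
      (by rw [← pushout.condition, Category.assoc]) : pushout a P'.f ⟶ pushout (a ≫ P.f) P'.f)
    w (fun A x => ?_) (fun A g => ?_)⟩
  · obtain ⟨f, hf⟩ := P.exists_map_gen (ι.app A x)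
    have := (h A).apply_apply_eq_zero x
    rw [← hf, hd, P'.map_gen_eq_zero_iff] at this
    obtain ⟨y, hy⟩ := this
    refine ⟨pushout.desc f y hy.symm, hι A ?_⟩
    rw [hF, pushout.inl_desc, hf]
  · rw [← map_eq_zero_iff (ι.app A).hom (hι A)]
    change ι.app A _ = 0 ↔ _
    rw [hF, P.map_gen_eq_zero_iff]
    constructor
    · rintro ⟨z, hz⟩
      refine ⟨pushout.desc z (pushout.inr _ _ ≫ g) ?_, ?_⟩
      · rw [Category.assoc, hz, pushout.condition_assoc]
      · refine pushout.hom_ext ?_ ?_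
        · rw [pushout.inl_desc_assoc, Category.assoc, pushout.inl_desc, hz]
        · rw [pushout.inr_desc_assoc, pushout.inr_desc]
    · rintro ⟨y, rfl⟩
      exact ⟨pushout.inl _ _ ≫ y, by rw [pushout.inl_desc_assoc, Category.assoc]⟩

/-- The cokernel of a morphism of finitely presented functors. -/
theorem exists_cokernel_sequence {F T : C ⥤ AddCommGrpCat.{v}} (PF : Presentation F)
    (P : Presentation T) (ι : F ⟶ T) :
    ∃ (m : P.X ⟶ PF.X) (q : T ⟶ coker (biprod.lift P.f m)),
      (∀ A, Function.Surjective (q.app A)) ∧ ∀ A, Function.Exact (ι.app A) (q.app A) := by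
  have := P.additive
  have := PF.additive
  -- Since `m` represents the image of the generator of F, dividing by the image of ι amounts to
  -- adding `m` to the relation `P.f`.
  obtain ⟨m, hm⟩ := P.exists_map_gen (ι.app _ PF.gen)
  obtain ⟨c, hc, hc'⟩ := exists_coker_gen (biprod.lift P.f m)
  obtain ⟨q, hq⟩ := P.exists_desc (G := coker (biprod.lift P.f m)) c
    ((hc' _ _).2 ⟨biprod.fst, biprod.lift_fst _ _⟩)
  have hq' {A : C} (f : P.X ⟶ A) :
      q.app A (T.map f P.gen) = (coker (biprod.lift P.f m)).map f c :=
    (NatTrans.naturality_apply q f _).trans (congrArg _ hq)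
  have hι {A : C} (f : PF.X ⟶ A) : ι.app A (F.map f PF.gen) = T.map (m ≫ f) P.gen := by
    rw [T.map_comp]
    exact (NatTrans.naturality_apply ι f _).trans (congrArg _ hm.symm)
  refine ⟨m, q, fun A x => ?_, fun A x => ⟨fun hx => ?_, ?_⟩⟩
  · obtain ⟨f, rfl⟩ := hc A x
    exact ⟨T.map f P.gen, hq' f⟩
  · obtain ⟨f, rfl⟩ := P.exists_map_gen x
    rw [hq'] at hx
    obtain ⟨y, rfl⟩ := (hc' A f).1 hx
    refine ⟨F.map (biprod.inr ≫ y) PF.gen, ?_⟩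
    have h0 : T.map (P.f ≫ biprod.inl ≫ y) P.gen = 0 :=
      (P.map_gen_eq_zero_iff _).2 ⟨_, rfl⟩
    have : biprod.lift P.f m ≫ y = P.f ≫ biprod.inl ≫ y + m ≫ biprod.inr ≫ y := by
      rw [biprod.lift_eq]; simp
    rw [hι, this, T.map_add]
    exact (zero_add _).symm.trans (congrArg (· + _) h0.symm)
  · rintro ⟨y, rfl⟩
    obtain ⟨f, rfl⟩ := PF.exists_map_gen y
    rw [hι, hq', hc']
    exact ⟨biprod.snd ≫ f, by simp⟩

end General

/-! ### Injective objects of the category of finitely presented functors -/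

section InjectiveFunctors

variable {C : Type u} [Category.{v} C] [Abelian C]

/-- The morphism of `fp(C, Ab)` given by a natural transformation. -/
def FP.ofNat {F G : FP C} (τ : F.obj.obj ⟶ G.obj.obj) : F ⟶ G := ⟨⟨τ⟩⟩

@[simp]
lemma FP.nat_comp {F G H : FP C} (α : F ⟶ G) (β : G ⟶ H) :
    FP.nat (α ≫ β) = FP.nat α ≫ FP.nat β := rfl

lemma FP.hom_ext {F G : FP C} {α β : F ⟶ G} (h : FP.nat α = FP.nat β) : α = β := by
  ext1; ext1; exact h

lemma FP.additive (F : FP C) : F.obj.obj.Additive := F.property.some.additive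

lemma FP.mono_of_injective {F G : FP C} (α : F ⟶ G)
    (h : ∀ A, Function.Injective ((FP.nat α).app A)) : Mono α where
  right_cancellation β γ hβ := by
    apply FP.hom_ext
    ext A x
    exact h A (congrArg (fun τ => (FP.nat τ).app A x) hβ)

/-- Elements of F(A) are transformations from (A, -), which is itself finitely presented as the
cokernel of the zero map (A, -) ⟶ (A, -). Testing the monomorphism on these gives pointwise
injectivity. -/
lemma FP.injective_of_mono {F G : FP C} (α : F ⟶ G) [Mono α] (A : C) :
    Function.Injective ((FP.nat α).app A) := by
  refine (injective_iff_map_eq_zero ((FP.nat α).app A).hom).2 fun x hx => ?_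
  let P := cokerPresentation (0 : A ⟶ A)
  have := F.additive
  obtain ⟨τ, hτ⟩ := P.exists_desc (G := F.obj.obj) x (by
    exact map_zero_apply _ x)
  have h0 : FP.ofNat (F := FP.coker _) τ ≫ α = FP.ofNat (F := FP.coker _) 0 ≫ α :=
    FP.hom_ext (P.hom_ext (((congrArg ((FP.nat α).app A) hτ).trans hx).trans
      (map_zero ((FP.nat α).app A).hom).symm))
  have h1 := congrArg FP.nat ((cancel_mono α).1 h0)
  rw [← hτ, show τ = 0 from h1]
  rfl

/-- A functor `F` is right exact if it sends right exact sequences to exact sequences. -/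
def IsRightExact (F : C ⥤ AddCommGrpCat.{v}) : Prop :=
  ∀ ⦃X Y Z : C⦄ (f : X ⟶ Y) (g : Y ⟶ Z) (w : f ≫ g = 0), (ShortComplex.mk f g w).Exact → Epi g →
    Function.Exact (F.map f) (F.map g)

/-- Right exact finitely presented functors are injective. -/
theorem FP.injective_of_isRightExact (I : FP C) (hI : IsRightExact I.obj.obj) : Injective I where
  factors {F G} φ α _ := by
    have := I.additive
    have := F.additive
    have := G.additive
    let P := F.property.some
    let P' := G.property.some
    obtain ⟨a, ha⟩ := P'.exists_map_gen ((FP.nat α).app _ P.gen)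
    have hα {A : C} (f : P.X ⟶ A) :
        (FP.nat α).app A (F.obj.obj.map f P.gen) = G.obj.obj.map (a ≫ f) P'.gen := by
      rw [Functor.map_comp]
      exact (NatTrans.naturality_apply (FP.nat α) f _).trans (congrArg _ ha.symm)
    -- In the pushout the image of the generator of F under α is killed by the relation `P'.f`.
    -- Since α is injective, the generator of F is already killed, so the right leg factors through
    -- `P.f`.
    obtain ⟨y, hy⟩ := (P.map_gen_eq_zero_iff (pushout.inr P'.f a)).1 (by
      apply FP.injective_of_mono α
      rw [hα, ← pushout.condition]
      exact ((P'.map_gen_eq_zero_iff _).2 ⟨_, rfl⟩).trans (map_zero _).symm)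
    let i := (FP.nat φ).app _ P.gen
    have hi : I.obj.obj.map P.f i = 0 := by
      refine (NatTrans.naturality_apply (FP.nat φ) P.f _).symm.trans ?_
      exact (congrArg _ P.map_f_gen).trans (map_zero _)
    have sq := IsPushout.of_hasPushout P'.f a
    have hex : Function.Exact (I.obj.obj.map (biprod.lift P'.f (-a)))
        (I.obj.obj.map (biprod.desc (pushout.inl P'.f a) (pushout.inr P'.f a))) :=
      hI _ _ sq.shortComplex.zero sq.exact_shortComplex sq.epi_shortComplex_g
    -- The element (0, i) vanishes in the pushout because i is killed by `P.f`. Right exactness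
    -- lifts it to j over `P'.X`; the sign in the sequence of the pushout makes -j the required
    -- image of the generator of G.
    obtain ⟨j, hj⟩ := (hex (I.obj.obj.map biprod.inr i)).1 (by
      rw [map_map_apply, biprod.inr_desc, ← hy, ← map_map_apply, hi, map_zero])
    have hj1 : I.obj.obj.map P'.f j = 0 := by
      have := congrArg (I.obj.obj.map (biprod.fst : P'.Y ⊞ P.X ⟶ _)) hj
      rwa [map_map_apply, map_map_apply, biprod.inr_fst, biprod.lift_fst,
        map_zero_apply] at this
    have hj2 : I.obj.obj.map a (-j) = i := by
      have := congrArg (I.obj.obj.map (biprod.snd : P'.Y ⊞ P.X ⟶ _)) hj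
      rw [map_map_apply, map_map_apply, biprod.inr_snd, biprod.lift_snd,
        map_id_apply, Functor.map_neg] at this
      rw [map_neg]
      exact this
    obtain ⟨ψ, hψ⟩ := P'.exists_desc (G := I.obj.obj) (-j) (by rw [map_neg, hj1, neg_zero])
    refine ⟨FP.ofNat ψ, FP.hom_ext (P.hom_ext ?_)⟩
    refine (congrArg (ψ.app _) ha.symm).trans ((NatTrans.naturality_apply ψ a _).trans ?_)
    exact (congrArg _ hψ).trans hj2

/-- Morphisms to an injective object extend along an exact sequence `F ⟶ T ⟶ T'`. -/
theorem FP.exists_extension {F T T' I : FP C} [Injective I] (ι : F.obj.obj ⟶ T.obj.obj)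
    (d : T.obj.obj ⟶ T'.obj.obj) (h : ∀ A, Function.Exact (ι.app A) (d.app A))
    (φ : T.obj.obj ⟶ I.obj.obj) (hφ : ι ≫ φ = 0) : ∃ ψ : T'.obj.obj ⟶ I.obj.obj, d ≫ ψ = φ := by
  have := I.additive
  have := T'.additive
  let P := T.property.some
  let PF := F.property.some
  obtain ⟨m, q, hq, hιq⟩ := exists_cokernel_sequence PF P ι
  -- The universal property of the cokernel of ι, for all additive targets.
  have key {H : C ⥤ AddCommGrpCat.{v}} [H.Additive] (τ : T.obj.obj ⟶ H) (hτ : ι ≫ τ = 0) :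
      ∃ σ : FunctorDefect.coker (biprod.lift P.f m) ⟶ H, q ≫ σ = τ := by
    obtain ⟨σ, hσ⟩ := exists_natTrans_of_relation
      (F := FunctorDefect.coker (biprod.lift P.f m)) (G := H)
      (fun A x y => ∃ t, q.app A t = x ∧ τ.app A t = y)
      (by
        rintro A _ _ _ _ ⟨t, rfl, rfl⟩ ⟨t', rfl, rfl⟩
        exact ⟨t - t', map_sub _ _ _, map_sub _ _ _⟩)
      (fun A x => by
        obtain ⟨t, rfl⟩ := hq A x
        exact ⟨_, t, rfl, rfl⟩)
      (by
        rintro A _ ⟨t, h1, rfl⟩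
        obtain ⟨s, rfl⟩ := (hιq A t).1 h1
        exact congrArg (fun α => α.app A s) hτ)
      (by
        rintro A B f _ _ ⟨t, rfl, rfl⟩
        exact ⟨T.obj.obj.map f t, NatTrans.naturality_apply q f t,
          NatTrans.naturality_apply τ f t⟩)
    refine ⟨σ, ?_⟩
    ext A t
    obtain ⟨t', h1, h2⟩ := hσ A (q.app A t)
    obtain ⟨s, hs⟩ := (hιq A (t' - t)).1 (by rw [map_sub, h1, sub_self])
    refine h2.symm.trans ?_
    rw [← sub_eq_zero, ← map_sub, ← hs]
    exact congrArg (fun α => α.app A s) hτ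
  obtain ⟨d', hd'⟩ := key d (by
    ext A x
    exact (h A).apply_apply_eq_zero x)
  obtain ⟨φ', hφ'⟩ := key φ hφ
  -- Exactness in the middle says that the cokernel of ι embeds into T', so injectivity of I extends
  -- the induced map φ' to T'.
  have hd'' (A) : Function.Injective (d'.app A) :=
    (injective_iff_map_eq_zero (d'.app A).hom).2 fun x hx => by
      obtain ⟨t, rfl⟩ := hq A x
      have : d.app A t = 0 := by rw [← hd']; exact hx
      obtain ⟨s, rfl⟩ := (h A t).1 this
      exact (hιq A).apply_apply_eq_zero s
  have : Mono (FP.ofNat (F := FP.coker (biprod.lift P.f m)) (G := T') d') :=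
    FP.mono_of_injective _ hd''
  refine ⟨FP.nat (Injective.factorThru (FP.ofNat (F := FP.coker (biprod.lift P.f m)) φ')
    (FP.ofNat (F := FP.coker (biprod.lift P.f m)) (G := T') d')), ?_⟩
  have h2 := congrArg FP.nat (Injective.comp_factorThru
    (FP.ofNat (F := FP.coker (biprod.lift P.f m)) φ')
    (FP.ofNat (F := FP.coker (biprod.lift P.f m)) (G := T') d'))
  rw [FP.nat_comp] at h2
  conv_lhs => rw [← hd', Category.assoc]
  exact (congrArg (q ≫ ·) h2).trans hφ'

end InjectiveFunctors

/-! ### Tensoring with free and projective modules; presentations of tensor functors -/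

section Flatness

variable {R : Type u} [Ring R]

variable (R) in
/-- The free left module `Rⁿ`. -/
abbrev leftPow (n : ℕ) : ModuleCat.{u} R := ModuleCat.of R (Fin n → R)

variable (R) in
/-- The free right module `Rⁿ`. -/
abbrev rightPow (n : ℕ) : ModuleCat.{u} Rᵐᵒᵖ := ModuleCat.of Rᵐᵒᵖ (Fin n → R)

/-- The standard basis vectors of the left module `Rⁿ`. -/
def leftBasis {n : ℕ} (i : Fin n) : leftPow R n := (Pi.single i 1 : Fin n → R)

/-- The standard basis vectors of the right module `Rⁿ`. -/
def rightBasis {n : ℕ} (i : Fin n) : rightPow R n := (Pi.single i 1 : Fin n → R)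

lemma leftPow_expand {n : ℕ} (x : leftPow R n) : x = ∑ i, (x i : R) • leftBasis i :=
  pi_eq_sum_univ' x

lemma rightPow_expand {n : ℕ} (x : rightPow R n) :
    x = ∑ i, MulOpposite.op (x i : R) • rightBasis i := by
  refine (pi_eq_sum_univ' (R := R) x).trans (Finset.sum_congr rfl fun i _ => ?_)
  funext j
  by_cases h : i = j <;> simp [rightBasis, h, eq_comm]

/-- The homomorphism of right modules `Rⁿ ⟶ A` with given values on the basis. -/
def rightPowHom {n : ℕ} {A : ModuleCat.{u} Rᵐᵒᵖ} (a : Fin n → A) : rightPow R n ⟶ A :=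
  ModuleCat.ofHom (R := Rᵐᵒᵖ) (X := Fin n → R)
    { toFun := fun x => ∑ i, MulOpposite.op (x i) • a i
      map_add' := fun x y => by simp [add_smul, Finset.sum_add_distrib]
      map_smul' := fun r x => by simp [mul_smul, Finset.smul_sum] }

lemma rightPowHom_apply {n : ℕ} {A : ModuleCat.{u} Rᵐᵒᵖ} (a : Fin n → A) (x : rightPow R n) :
    rightPowHom a x = ∑ i, MulOpposite.op (x i : R) • a i :=
  rfl

@[simp]
lemma rightPowHom_basis {n : ℕ} {A : ModuleCat.{u} Rᵐᵒᵖ} (a : Fin n → A) (i : Fin n) :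
    rightPowHom a (rightBasis i) = a i := by
  change ∑ j, MulOpposite.op ((Pi.single i 1 : Fin n → R) j) • a j = a i
  rw [Finset.sum_eq_single i] <;> simp +contextual

lemma rightPow_hom_ext {n : ℕ} {A : ModuleCat.{u} Rᵐᵒᵖ} {f g : rightPow R n ⟶ A}
    (h : ∀ i, f (rightBasis i) = g (rightBasis i)) : f = g := by
  refine ConcreteCategory.hom_ext _ _ fun x => ?_
  rw [rightPow_expand x, map_sum, map_sum]
  refine Finset.sum_congr rfl fun i _ => ?_
  exact (f.hom.map_smul _ _).trans ((congrArg _ (h i)).trans (g.hom.map_smul _ _).symm)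

/-- The homomorphism of left modules `Rⁿ ⟶ A` with given values on the basis. -/
def leftPowHom {n : ℕ} {A : ModuleCat.{u} R} (a : Fin n → A) : leftPow R n ⟶ A :=
  ModuleCat.ofHom (Fintype.linearCombination R a)

@[simp]
lemma leftPowHom_basis {n : ℕ} {A : ModuleCat.{u} R} (a : Fin n → A) (i : Fin n) :
    leftPowHom a (leftBasis i) = a i := by
  change Fintype.linearCombination R a (Pi.single i 1) = a i
  simp

/-- The coordinates of an element of `A ⊗_R Rⁿ`. -/
def tensorCoord {n : ℕ} (A : ModuleCat.{u} Rᵐᵒᵖ) (i : Fin n) :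
    (tensorFunctor (leftPow R n)).obj A →+ A :=
  (tensorRegularHom A).comp
    ((tensorMap (ModuleCat.ofHom (LinearMap.proj i) : leftPow R n ⟶ leftReg R)).app A).hom

lemma tensorCoord_pure {n : ℕ} {A : ModuleCat.{u} Rᵐᵒᵖ} (i : Fin n) (a : A)
    (x : leftPow R n) :
    tensorCoord A i (pureTensor _ A a x) = MulOpposite.op (x i : R) • a :=
  rfl

lemma tensorCoord_basis {n : ℕ} {A : ModuleCat.{u} Rᵐᵒᵖ} (i j : Fin n) (a : A) :
    tensorCoord A i (pureTensor _ A a (leftBasis j)) = if i = j then a else 0 := by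
  rw [tensorCoord_pure]
  by_cases h : i = j <;> simp [leftBasis, h]

lemma tensorCoord_naturality {n : ℕ} {A B : ModuleCat.{u} Rᵐᵒᵖ} (f : A ⟶ B) (i : Fin n)
    (x : (tensorFunctor (leftPow R n)).obj A) :
    tensorCoord B i ((tensorFunctor _).map f x) = f (tensorCoord A i x) := by
  induction x using tensor_induction with
  | pure a m =>
    rw [tensorFunctor_map_pure, tensorCoord_pure, tensorCoord_pure]
    exact (f.hom.map_smul _ _).symm
  | add x y hx hy => rw [map_add, map_add, hx, hy, map_add, map_add]

lemma sum_tensorCoord {n : ℕ} {A : ModuleCat.{u} Rᵐᵒᵖ}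
    (x : (tensorFunctor (leftPow R n)).obj A) :
    ∑ i, pureTensor _ A (tensorCoord A i x) (leftBasis i) = x := by
  induction x using tensor_induction with
  | pure a m =>
    conv_rhs => rw [leftPow_expand m, map_sum]
    exact Finset.sum_congr rfl fun i _ => pureTensor_smul a (m i : R) (leftBasis i)
  | add x y hx hy =>
    simp only [map_add, AddMonoidHom.add_apply, Finset.sum_add_distrib, hx, hy]

/-- By `tensorCoord` and `sum_tensorCoord`, A ⊗ Rⁿ is Aⁿ naturally in A, and exactness is checked
coordinatewise. -/
lemma exact_tensorFunctor_leftPow (n : ℕ) {A B C : ModuleCat.{u} Rᵐᵒᵖ} (f : A ⟶ B) (g : B ⟶ C)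
    (h : Function.Exact f g) :
    Function.Exact ((tensorFunctor (leftPow R n)).map f) ((tensorFunctor (leftPow R n)).map g) := by
  intro x
  constructor
  · intro hx
    have hx' (i : Fin n) : ∃ a, f a = tensorCoord B i x :=
      (h _).1 (by rw [← tensorCoord_naturality, hx, map_zero])
    choose a ha using hx'
    refine ⟨∑ i, pureTensor _ A (a i) (leftBasis i), ?_⟩
    rw [map_sum, ← sum_tensorCoord x]
    exact Finset.sum_congr rfl fun i _ =>
      congrArg (fun b => pureTensor (leftPow R n) B b (leftBasis i)) (ha i)
  · rintro ⟨y, rfl⟩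
    rw [map_map_apply, show f ≫ g = 0 by ext z; exact h.apply_apply_eq_zero z, map_zero_apply]

/-- Tensoring with a finitely generated projective module is exact. -/
theorem exact_tensorFunctor_of_projective (L : ModuleCat.{u} R) [Module.Finite R L]
    [Module.Projective R L] {A B C : ModuleCat.{u} Rᵐᵒᵖ} (f : A ⟶ B) (g : B ⟶ C)
    (h : Function.Exact f g) :
    Function.Exact ((tensorFunctor L).map f) ((tensorFunctor L).map g) := by
  -- L is a retract of Rⁿ, and exactness passes to retracts of functors.
  obtain ⟨n, p, s, -, -, hps⟩ := Module.Finite.exists_comp_eq_id_of_projective R L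
  let p' : leftPow R n ⟶ L := ModuleCat.ofHom p
  let s' : L ⟶ leftPow R n := ModuleCat.ofHom s
  have hsp (A) (x : (tensorFunctor L).obj A) :
      (tensorMap p').app A ((tensorMap s').app A x) = x := by
    have : s' ≫ p' = 𝟙 L := by ext x; exact LinearMap.congr_fun hps x
    refine (congrArg (fun τ => τ.app A x) (tensorMap_comp s' p')).symm.trans ?_
    rw [this, tensorMap_id]; rfl
  intro x
  constructor
  · intro hx
    obtain ⟨y, hy⟩ := (exact_tensorFunctor_leftPow n f g h ((tensorMap s').app B x)).1 (by
      refine (NatTrans.naturality_apply (tensorMap s') g x).symm.trans ?_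
      rw [hx, map_zero])
    refine ⟨(tensorMap p').app A y, ?_⟩
    rw [← hsp B x, ← hy]
    exact (NatTrans.naturality_apply (tensorMap p') f y).symm
  · rintro ⟨y, rfl⟩
    rw [map_map_apply, show f ≫ g = 0 by ext z; exact h.apply_apply_eq_zero z, map_zero_apply]

/-- Injectivity is expressed as exactness after the zero endomorphism of A, which replaces the map
from the zero module. -/
theorem injective_tensorFunctor_of_projective (L : ModuleCat.{u} R) [Module.Finite R L]
    [Module.Projective R L] {A B : ModuleCat.{u} Rᵐᵒᵖ} (f : A ⟶ B)
    (h : Function.Injective f) : Function.Injective ((tensorFunctor L).map f) := by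
  refine (injective_iff_map_eq_zero ((tensorFunctor L).map f).hom).2 fun x hx => ?_
  obtain ⟨y, rfl⟩ := (exact_tensorFunctor_of_projective L (0 : A ⟶ A) f (fun x =>
    ⟨fun hx => ⟨0, (map_zero _).trans ((injective_iff_map_eq_zero f.hom).1 h x hx).symm⟩,
      by rintro ⟨y, rfl⟩; exact map_zero f.hom⟩) x).1 hx
  exact map_zero_apply _ y

/-- Tensoring with a projective right module preserves injections. -/
theorem injective_tensorMap_of_projective {M N : ModuleCat.{u} R} (g : M ⟶ N)
    (hg : Function.Injective g) (P : ModuleCat.{u} Rᵐᵒᵖ) [Projective P] :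
    Function.Injective ((tensorMap g).app P) := by
  -- A section s of the free cover of P embeds P ⊗ K, by a map c with retraction w, into a direct
  -- sum of copies of K, compatibly with maps in K. Injectivity is then clear on direct sums.
  obtain ⟨s, hs⟩ := (IsProjective.iff_projective (R := Rᵐᵒᵖ) P).2 inferInstance |>.out
  let c (K : ModuleCat.{u} R) : (tensorFunctor K).obj P →+ (P →₀ K) :=
    tensorLift (AddMonoidHom.mk' (fun a => AddMonoidHom.mk'
        (fun k : K => (s a).mapRange (fun r : Rᵐᵒᵖ => r.unop • k) (zero_smul R k))
        (fun k k' => by ext; simp))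
      (fun a b => by ext; simp [add_smul]))
      (fun a r m => by ext; simp [mul_smul])
  let w (K : ModuleCat.{u} R) : (P →₀ K) →+ (tensorFunctor K).obj P :=
    Finsupp.liftAddHom (fun a => pureTensor K P a)
  have hw (K : ModuleCat.{u} R) (x) : w K (c K x) = x := by
    induction x using tensor_induction with
    | pure a k =>
      change Finsupp.liftAddHom (fun a => pureTensor K P a)
        ((s a).mapRange (fun r : Rᵐᵒᵖ => r.unop • k) (zero_smul R k)) = _
      rw [Finsupp.liftAddHom_apply, Finsupp.sum_mapRange_index (by simp)]
      conv_rhs => rw [← hs a, Finsupp.linearCombination_apply, Finsupp.sum, map_sum]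
      rw [AddMonoidHom.finsetSum_apply]
      exact Finset.sum_congr rfl fun b _ => (pureTensor_smul b ((s a) b).unop k).symm
    | add x y hx hy => rw [map_add, map_add, hx, hy]
  have hc (x) : c N ((tensorMap g).app P x) = (c M x).mapRange g (map_zero g.hom) := by
    induction x using tensor_induction with
    | pure a k =>
      ext b
      exact (g.hom.map_smul ((s a b).unop) k).symm
    | add x y hx hy =>
      rw [map_add, map_add, map_add, hx, hy]
      exact (Finsupp.mapRange_add (fun a b => map_add g.hom a b) _ _).symm
  intro x y hxy
  rw [← hw M x, ← hw M y]
  congr 1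
  apply Finsupp.mapRange_injective g (map_zero g.hom) hg
  rw [← hc, ← hc, hxy]

lemma isRightExact_tensorFunctor (M : ModuleCat.{u} R) : IsRightExact (tensorFunctor M) := by
  intro X Y Z f g w h hg
  exact tensorFunctor_map_exact M f g
    ((ShortComplex.ShortExact.moduleCat_exact_iff_function_exact _).1 h)
    ((ModuleCat.epi_iff_surjective _).1 hg)

/-- A presentation `Rᵐ ⟶ Rⁿ ⟶ V ⟶ 0` of a left module yields a presentation of `- ⊗_R V` by the
transposed map of right modules. -/
def tensorPresentation {n m : ℕ} (d : leftPow R m ⟶ leftPow R n)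
    (f : rightPow R n ⟶ rightPow R m) (hdf : ∀ i j, (d (leftBasis j) i : R) = f (rightBasis i) j)
    {V : ModuleCat.{u} R} (p : leftPow R n ⟶ V) (hp : Function.Surjective p)
    (hdp : Function.Exact d p) : Presentation (tensorFunctor V) :=
  -- This is the element corresponding to p under Rⁿ ⊗ V ≅ Vⁿ. Its image under a map x from Rⁿ to A
  -- is the class of the tensor with coordinates x(eᵢ), so every element of A ⊗ V arises.
  Presentation.ofGen f (∑ i, pureTensor V (rightPow R n) (rightBasis i) (p (leftBasis i)))
    (fun A a => by
      obtain ⟨t, rfl⟩ := tensorMap_surjective p hp A a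
      refine ⟨rightPowHom fun i => tensorCoord A i t, ?_⟩
      conv_rhs => rw [← sum_tensorCoord t, map_sum]
      rw [map_sum]
      refine Finset.sum_congr rfl fun i _ => ?_
      rw [tensorFunctor_map_pure, rightPowHom_basis, tensorMap_pure])
    (fun A x => by
      constructor
      · intro hx
        -- If the image in A ⊗ V vanishes, the tensor comes from t in A ⊗ Rᵐ, and the coordinates of
        -- t define the factorization through the transpose f.
        obtain ⟨t, ht⟩ := (tensorMap_exact d p hdp hp A
          (∑ i, pureTensor (leftPow R n) A (x (rightBasis i)) (leftBasis i))).1 (by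
            rw [map_sum] at hx ⊢
            exact hx)
        refine ⟨rightPowHom fun j => tensorCoord A j t, rightPow_hom_ext fun i => ?_⟩
        have h1 : tensorCoord A i (∑ i, pureTensor (leftPow R n) A (x (rightBasis i))
            (leftBasis i)) = x (rightBasis i) := by
          rw [map_sum, Finset.sum_eq_single i (fun j _ hj => ?_) (by simp), tensorCoord_basis,
            if_pos rfl]
          rw [tensorCoord_basis, if_neg hj.symm]
        rw [← h1, ← ht]
        conv_rhs => rw [← sum_tensorCoord t, map_sum, map_sum]
        refine (rightPowHom_apply _ (f (rightBasis i))).trans (Finset.sum_congr rfl fun j _ => ?_)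
        exact congrArg (fun r => MulOpposite.op r • tensorCoord A j t) (hdf i j).symm
      · rintro ⟨y, rfl⟩
        have h0 : (tensorFunctor V).map f
            (∑ i, pureTensor V (rightPow R n) (rightBasis i) (p (leftBasis i))) = 0 := by
          rw [map_sum]
          have h1 (i : Fin n) : (tensorFunctor V).map f
              (pureTensor V (rightPow R n) (rightBasis i) (p (leftBasis i))) =
              ∑ j, pureTensor V (rightPow R m) (rightBasis j)
                (p ((d (leftBasis j) i : R) • leftBasis i)) := by
            rw [tensorFunctor_map_pure]
            conv_lhs => rw [rightPow_expand (f (rightBasis i)), map_sum]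
            rw [AddMonoidHom.finsetSum_apply]
            refine Finset.sum_congr rfl fun j _ => ?_
            rw [pureTensor_smul, hdf]
            exact congrArg _ (p.hom.map_smul _ _).symm
          simp only [h1]
          rw [Finset.sum_comm]
          refine Finset.sum_eq_zero fun j _ => ?_
          rw [← map_sum, ← map_sum, ← leftPow_expand, hdp.apply_apply_eq_zero, map_zero]
        rw [← map_map_apply, h0, map_zero])

/-- The transpose of a homomorphism of free right modules. -/
lemma exists_left_transpose {n m : ℕ} (f : rightPow R n ⟶ rightPow R m) :
    ∃ d : leftPow R m ⟶ leftPow R n, ∀ i j, (d (leftBasis j) i : R) = f (rightBasis i) j :=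
  ⟨leftPowHom fun j => (fun i => (f (rightBasis i) j : R) : Fin n → R), fun i j => by
    rw [leftPowHom_basis]⟩

/-- The transpose of a homomorphism of free left modules. -/
lemma exists_right_transpose {n m : ℕ} (d : leftPow R m ⟶ leftPow R n) :
    ∃ f : rightPow R n ⟶ rightPow R m, ∀ i j, (d (leftBasis j) i : R) = f (rightBasis i) j :=
  ⟨rightPowHom fun i => (fun j => (d (leftBasis j) i : R) : Fin m → R), fun i j => by
    rw [rightPowHom_basis]⟩

theorem nonempty_presentation_tensorFunctor (V : ModuleCat.{u} R)
    [Module.FinitePresentation R V] : Nonempty (Presentation (tensorFunctor V)) := by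
  obtain ⟨n, m, p, d, hp, hdp⟩ := Module.FinitePresentation.exists_fin' R V
  obtain ⟨f, hf⟩ := exists_right_transpose (ModuleCat.ofHom d : leftPow R m ⟶ leftPow R n)
  exact ⟨tensorPresentation _ f hf (ModuleCat.ofHom p : leftPow R n ⟶ V) hp hdp⟩

/-- The functor `- ⊗_R V` for a finitely presented left module `V`, as a finitely presented
functor. -/
def FP.tensor (V : ModuleCat.{u} R) [Module.FinitePresentation R V] :
    FP (ModuleCat.{u} Rᵐᵒᵖ) :=
  ⟨AdditiveFunctor.of (tensorFunctor V), nonempty_presentation_tensorFunctor V⟩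

instance (V : ModuleCat.{u} R) [Module.FinitePresentation R V] : Injective (FP.tensor V) :=
  FP.injective_of_isRightExact _ (isRightExact_tensorFunctor V)

end Flatness

/-! ### Kernels and cokernels of abelian groups in terms of elements -/

section AbElements

lemma ab_kernel_ι_injective {A B : AddCommGrpCat.{u}} (f : A ⟶ B) :
    Function.Injective (kernel.ι f) :=
  (AddCommGrpCat.mono_iff_injective _).1 inferInstance

lemma ab_kernel_exact {A B : AddCommGrpCat.{u}} (f : A ⟶ B) :
    Function.Exact (kernel.ι f) f :=
  (ShortComplex.ab_exact_iff_function_exact _).1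
    (ShortComplex.exact_kernel f)

lemma ab_cokernel_π_surjective {A B : AddCommGrpCat.{u}} (f : A ⟶ B) :
    Function.Surjective (cokernel.π f) :=
  (AddCommGrpCat.epi_iff_surjective _).1 inferInstance

lemma ab_cokernel_exact {A B : AddCommGrpCat.{u}} (f : A ⟶ B) :
    Function.Exact f (cokernel.π f) :=
  (ShortComplex.ab_exact_iff_function_exact _).1
    (ShortComplex.exact_cokernel f)

end AbElements

/-! ### The right satellite of a cokernel of representable functors -/

section RightSatellite

variable {C : Type u} [Category.{v} C] [Abelian C]

/-- The functor `G` is a cokernel of `(g, -) : (V₁, -) ⟶ (V₀, -)`. -/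
def IsPresentedBy (G : C ⥤ AddCommGrpCat.{v}) {V₀ V₁ : C} (g : V₀ ⟶ V₁) : Prop :=
  ∃ x : G.obj V₀, (∀ (A : C) (a : G.obj A), ∃ f : V₀ ⟶ A, G.map f x = a) ∧
    ∀ (A : C) (f : V₀ ⟶ A), G.map f x = 0 ↔ ∃ y : V₁ ⟶ A, g ≫ y = f

variable [EnoughInjectives C]

/-- The connecting relation between morphisms `K ⟶ B` and `V ⟶ ΣB` for a short exact sequence
`0 ⟶ K ⟶ L ⟶ V ⟶ 0`. -/
def IsConnected (S : ShortComplex C) {B : C} (φ : S.X₁ ⟶ B) (ψ : S.X₃ ⟶ cosyz B) : Prop :=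
  ∃ e : S.X₂ ⟶ Injective.under B, S.f ≫ e = φ ≫ Injective.ι B ∧ e ≫ cosyzπ B = S.g ≫ ψ

namespace IsConnected

variable {S : ShortComplex C} (hS : S.ShortExact) {B : C}

-- The composite of φ with B ⟶ I extends over L because I is injective. With the next lemmas, for L
-- projective, this identifies Hom(K, B) modulo maps extending to L with Hom(V, ΣB) modulo maps
-- lifting to I, both being Ext¹(V, B).
include hS in
lemma exists_right (φ : S.X₁ ⟶ B) : ∃ ψ, IsConnected S φ ψ := by
  have := hS.mono_f
  have := hS.epi_g
  let e := Injective.factorThru (φ ≫ Injective.ι B) S.f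
  have he : S.f ≫ e = φ ≫ Injective.ι B := Injective.comp_factorThru _ _
  have h0 : S.f ≫ e ≫ cosyzπ B = 0 := by
    rw [← Category.assoc, he, Category.assoc, cokernel.condition, comp_zero]
  exact ⟨hS.exact.desc _ h0, e, he, (hS.exact.g_desc _ h0).symm⟩

/-- Here projectivity of the middle term lifts V ⟶ ΣB to L ⟶ I. -/
lemma exists_left [Projective S.X₂] (ψ : S.X₃ ⟶ cosyz B) : ∃ φ, IsConnected S φ ψ := by
  have he : Projective.factorThru (S.g ≫ ψ) (cosyzπ B) ≫ cosyzπ B = S.g ≫ ψ :=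
    Projective.factorThru_comp _ _
  have hT : (ShortComplex.mk (Injective.ι B) (cosyzπ B) (cokernel.condition _)).Exact :=
    ShortComplex.exact_cokernel _
  have h0 : (S.f ≫ Projective.factorThru (S.g ≫ ψ) (cosyzπ B)) ≫ cosyzπ B = 0 := by
    rw [Category.assoc, he, S.zero_assoc, zero_comp]
  exact ⟨hT.lift _ h0, _, (hT.lift_f _ h0).symm, he⟩

lemma comp {φ : S.X₁ ⟶ B} {ψ : S.X₃ ⟶ cosyz B} (h : IsConnected S φ ψ) {B' : C} (f : B ⟶ B') :
    IsConnected S (φ ≫ f) (ψ ≫ cosyzMap f) := by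
  obtain ⟨e, h1, h2⟩ := h
  refine ⟨e ≫ cosyzExt f, ?_, ?_⟩
  · rw [← Category.assoc, h1, Category.assoc, Category.assoc, ι_cosyzExt]
  · rw [Category.assoc, ← π_cosyzMap, ← Category.assoc, h2, Category.assoc]

lemma precomp {T : ShortComplex C} (α : S ⟶ T) {φ : T.X₁ ⟶ B} {ψ : T.X₃ ⟶ cosyz B}
    (h : IsConnected T φ ψ) : IsConnected S (α.τ₁ ≫ φ) (α.τ₃ ≫ ψ) := by
  obtain ⟨e, h1, h2⟩ := h
  refine ⟨α.τ₂ ≫ e, ?_, ?_⟩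
  · rw [← α.comm₁₂_assoc, h1, Category.assoc]
  · rw [Category.assoc, h2, α.comm₂₃_assoc]

lemma sub {φ φ' : S.X₁ ⟶ B} {ψ ψ' : S.X₃ ⟶ cosyz B} (h : IsConnected S φ ψ)
    (h' : IsConnected S φ' ψ') : IsConnected S (φ - φ') (ψ - ψ') := by
  obtain ⟨e, h1, h2⟩ := h
  obtain ⟨e', h1', h2'⟩ := h'
  exact ⟨e - e', by rw [Preadditive.comp_sub, h1, h1', Preadditive.sub_comp],
    by rw [Preadditive.sub_comp, h2, h2', Preadditive.comp_sub]⟩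

-- If φ is zero, then the connecting map L ⟶ I vanishes on K and descends to V.
include hS in
lemma factors_right {ψ : S.X₃ ⟶ cosyz B} (h : IsConnected S 0 ψ) :
    ∃ θ : S.X₃ ⟶ Injective.under B, θ ≫ cosyzπ B = ψ := by
  have := hS.epi_g
  obtain ⟨e, h1, h2⟩ := h
  rw [zero_comp] at h1
  exact ⟨hS.exact.desc e h1, by rw [← cancel_epi S.g, ← Category.assoc, hS.exact.g_desc, h2]⟩

/-- Subtracting `S.g ≫ θ` from the connecting map L ⟶ I leaves a map into the kernel B of I ⟶ ΣB,
without changing its restriction to K. -/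
lemma factors_left {φ : S.X₁ ⟶ B} {θ : S.X₃ ⟶ Injective.under B}
    (h : IsConnected S φ (θ ≫ cosyzπ B)) : ∃ ξ : S.X₂ ⟶ B, S.f ≫ ξ = φ := by
  obtain ⟨e, h1, h2⟩ := h
  have hT : (ShortComplex.mk (Injective.ι B) (cosyzπ B) (cokernel.condition _)).Exact :=
    ShortComplex.exact_cokernel _
  have h0 : (e - S.g ≫ θ) ≫ cosyzπ B = 0 := by
    rw [Preadditive.sub_comp, h2, Category.assoc, sub_self]
  refine ⟨hT.lift _ h0, ?_⟩
  rw [← cancel_mono (Injective.ι B), Category.assoc]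
  refine (congrArg (S.f ≫ ·) (hT.lift_f _ h0)).trans ?_
  change S.f ≫ (e - S.g ≫ θ) = _
  rw [Preadditive.comp_sub, h1, S.zero_assoc, zero_comp, sub_zero]

end IsConnected

/-- If `G` is the cokernel of `(g, -)`, then `S¹G` is the cokernel of `(k, -)`, where `k` is
induced by `g` on syzygies, provided that the middle component is a split monomorphism. -/
theorem IsPresentedBy.rightSatelliteOne {S T : ShortComplex C} (hS : S.ShortExact)
    (hT : T.ShortExact) [Projective S.X₂] [Projective T.X₂] (α : S ⟶ T) (r : T.X₂ ⟶ S.X₂)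
    (hr : α.τ₂ ≫ r = 𝟙 _) {G : C ⥤+ AddCommGrpCat.{v}} (hG : IsPresentedBy G.obj α.τ₃) :
    IsPresentedBy (rightSatelliteOne G) α.τ₁ := by
  obtain ⟨x, hx, hx'⟩ := hG
  let c (B : C) : G.obj.obj (cosyz B) ⟶ (FunctorDefect.rightSatelliteOne G).obj B :=
    cokernel.π (G.obj.map (cosyzπ B))
  have hc (B : C) : Function.Surjective (c B) := ab_cokernel_π_surjective _
  have hc' (B : C) : Function.Exact (G.obj.map (cosyzπ B)) (c B) := ab_cokernel_exact _
  have hc0 {B : C} {ψ : S.X₃ ⟶ cosyz B} (h : IsConnected S 0 ψ) : c B (G.obj.map ψ x) = 0 := by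
    obtain ⟨θ, rfl⟩ := h.factors_right hS
    exact (hc' B _).2 ⟨G.obj.map θ x, map_map_apply _ _ _ _⟩
  have huniq {B : C} {φ : S.X₁ ⟶ B} {ψ ψ' : S.X₃ ⟶ cosyz B} (h : IsConnected S φ ψ)
      (h' : IsConnected S φ ψ') : c B (G.obj.map ψ x) = c B (G.obj.map ψ' x) := by
    rw [← sub_eq_zero, ← map_sub]
    have := hc0 (by simpa using h.sub h')
    rwa [Functor.map_sub] at this
  -- A partner of the identity of K yields the generator of S¹G; `key` computes its image under any
  -- φ from any partner ψ of φ.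
  obtain ⟨ψ₀, hψ₀⟩ := IsConnected.exists_right hS (𝟙 S.X₁)
  have key {B : C} {φ : S.X₁ ⟶ B} {ψ : S.X₃ ⟶ cosyz B} (h : IsConnected S φ ψ) :
      (FunctorDefect.rightSatelliteOne G).map φ (c _ (G.obj.map ψ₀ x)) = c B (G.obj.map ψ x) := by
    have h1 := congrArg (fun h => h (G.obj.map ψ₀ x)) (π_rightSatelliteMap G φ)
    refine h1.trans ?_
    change c B (G.obj.map (cosyzMap φ) (G.obj.map ψ₀ x)) = _
    rw [map_map_apply]
    exact huniq (by simpa using hψ₀.comp φ) h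
  refine ⟨c _ (G.obj.map ψ₀ x), fun B s => ?_, fun B φ => ⟨fun h => ?_, ?_⟩⟩
  · obtain ⟨t, rfl⟩ := hc B s
    obtain ⟨ψ, rfl⟩ := hx _ t
    obtain ⟨φ, hφ⟩ := IsConnected.exists_left (S := S) ψ
    exact ⟨φ, key hφ⟩
  · obtain ⟨ψ, hψ⟩ := IsConnected.exists_right hS φ
    rw [key hψ] at h
    obtain ⟨t, ht⟩ := (hc' B _).1 h
    obtain ⟨θ, rfl⟩ := hx _ t
    rw [map_map_apply] at ht
    have h2 : G.obj.map (ψ - θ ≫ cosyzπ B) x = 0 := by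
      rw [Functor.map_sub]
      exact sub_eq_zero.2 ht.symm
    obtain ⟨ψ₁, hψ₁⟩ := (hx' _ _).1 h2
    obtain ⟨φ₁, hφ₁⟩ := IsConnected.exists_left (S := T) ψ₁
    have h3 := hψ.sub (hφ₁.precomp α)
    rw [hψ₁, sub_sub_cancel] at h3
    obtain ⟨ξ, hξ⟩ := h3.factors_left
    -- The error term extends over `S.X₂` through ξ. The retraction r extends it further over
    -- `T.X₂`, so it too factors through `α.τ₁`; this is the only use of the splitting.
    refine ⟨φ₁ + T.f ≫ r ≫ ξ, ?_⟩
    rw [Preadditive.comp_add, α.comm₁₂_assoc, reassoc_of% hr, hξ, add_sub_cancel]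
  · rintro ⟨φ₁, rfl⟩
    obtain ⟨ψ₁, hψ₁⟩ := IsConnected.exists_right hT φ₁
    rw [key (hψ₁.precomp α), (hx' _ (α.τ₃ ≫ ψ₁)).2 ⟨ψ₁, rfl⟩, map_zero]

end RightSatellite

/-! ### The left satellite of a kernel of tensor functors -/

section LeftSatellite

variable {R : Type u} [Ring R]

/-- The functor `F` is a kernel of `- ⊗_R g : - ⊗_R V₀ ⟶ - ⊗_R V₁`. -/
def IsTensorKernel (F : ModuleCat.{u} Rᵐᵒᵖ ⥤ AddCommGrpCat.{u}) {V₀ V₁ : ModuleCat.{u} R}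
    (g : V₀ ⟶ V₁) : Prop :=
  ∃ ι : F ⟶ tensorFunctor V₀, (∀ A, Function.Injective (ι.app A)) ∧
    ∀ A, Function.Exact (ι.app A) ((tensorMap g).app A)

/-- The connecting relation between elements of `ΩA ⊗_R V` and `A ⊗_R K` for a short exact
sequence `0 ⟶ K ⟶ L ⟶ V ⟶ 0`. -/
def IsTensorConnected (S : ShortComplex (ModuleCat.{u} R)) {A : ModuleCat.{u} Rᵐᵒᵖ}
    (x : (tensorFunctor S.X₃).obj (syz A)) (y : (tensorFunctor S.X₁).obj A) : Prop :=
  ∃ (t : (tensorFunctor S.X₂).obj (syz A)) (z : (tensorFunctor S.X₁).obj (Projective.over A)),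
    (tensorMap S.g).app _ t = x ∧
    (tensorFunctor S.X₂).map (syzι A) t = (tensorMap S.f).app _ z ∧
    (tensorFunctor S.X₁).map (Projective.π A) z = y

lemma tensorMap_naturality {M N : ModuleCat.{u} R} (g : M ⟶ N) {A B : ModuleCat.{u} Rᵐᵒᵖ}
    (f : A ⟶ B) (x : (tensorFunctor M).obj A) :
    (tensorMap g).app B ((tensorFunctor M).map f x) =
      (tensorFunctor N).map f ((tensorMap g).app A x) :=
  NatTrans.naturality_apply (tensorMap g) f x

lemma tensorMap_tensorMap {M N K : ModuleCat.{u} R} (f : M ⟶ N) (g : N ⟶ K)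
    {A : ModuleCat.{u} Rᵐᵒᵖ} (x : (tensorFunctor M).obj A) :
    (tensorMap g).app A ((tensorMap f).app A x) = (tensorMap (f ≫ g)).app A x := by
  rw [tensorMap_comp]; rfl

lemma syz_exact (A : ModuleCat.{u} Rᵐᵒᵖ) : Function.Exact (syzι A) (Projective.π A) :=
  (ShortComplex.ShortExact.moduleCat_exact_iff_function_exact _).1
    (ShortComplex.exact_kernel (Projective.π A))

lemma syz_injective (A : ModuleCat.{u} Rᵐᵒᵖ) : Function.Injective (syzι A) :=
  (ModuleCat.mono_iff_injective _).1 inferInstance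

lemma syz_surjective (A : ModuleCat.{u} Rᵐᵒᵖ) : Function.Surjective (Projective.π A) :=
  (ModuleCat.epi_iff_surjective _).1 inferInstance

namespace IsTensorConnected

variable {S : ShortComplex (ModuleCat.{u} R)} (hS : S.ShortExact) {A : ModuleCat.{u} Rᵐᵒᵖ}

include hS in
lemma tensor_exact (A : ModuleCat.{u} Rᵐᵒᵖ) :
    Function.Exact ((tensorMap S.f).app A) ((tensorMap S.g).app A) :=
  tensorMap_exact _ _
    ((ShortComplex.ShortExact.moduleCat_exact_iff_function_exact _).1 hS.exact)
    hS.moduleCat_surjective_g A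

-- A snake argument: right exactness lifts x to ΩA ⊗ L and its image in P ⊗ L to P ⊗ K. The relation
-- matches ker(ΩA ⊗ V ⟶ P ⊗ V) with ker(A ⊗ K ⟶ A ⊗ L); when L is flat, both are Tor₁(A, V).
include hS in
lemma exists_right (x : (tensorFunctor S.X₃).obj (syz A))
    (hx : (tensorFunctor S.X₃).map (syzι A) x = 0) : ∃ y, IsTensorConnected S x y := by
  obtain ⟨t, rfl⟩ := tensorMap_surjective S.g hS.moduleCat_surjective_g _ x
  rw [← tensorMap_naturality] at hx
  obtain ⟨z, hz⟩ := (tensor_exact hS _ _).1 hx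
  exact ⟨_, t, z, rfl, hz.symm, rfl⟩

lemma exists_left (y : (tensorFunctor S.X₁).obj A) (hy : (tensorMap S.f).app A y = 0) :
    ∃ x, IsTensorConnected S x y := by
  obtain ⟨z, rfl⟩ := tensorFunctor_map_surjective S.X₁ (Projective.π A) (syz_surjective A) y
  rw [tensorMap_naturality] at hy
  obtain ⟨t, ht⟩ := (tensorFunctor_map_exact S.X₂ _ _ (syz_exact A) (syz_surjective A) _).1 hy
  exact ⟨_, t, z, rfl, ht, rfl⟩

include hS in
lemma map_left {x : (tensorFunctor S.X₃).obj (syz A)} {y : (tensorFunctor S.X₁).obj A}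
    (h : IsTensorConnected S x y) : (tensorFunctor S.X₃).map (syzι A) x = 0 := by
  obtain ⟨t, z, rfl, h2, -⟩ := h
  rw [← tensorMap_naturality, h2]
  exact (tensor_exact hS _).apply_apply_eq_zero z

lemma sub {x x' : (tensorFunctor S.X₃).obj (syz A)} {y y' : (tensorFunctor S.X₁).obj A}
    (h : IsTensorConnected S x y) (h' : IsTensorConnected S x' y') :
    IsTensorConnected S (x - x') (y - y') := by
  obtain ⟨t, z, rfl, h2, rfl⟩ := h
  obtain ⟨t', z', rfl, h2', rfl⟩ := h'
  exact ⟨t - t', z - z', map_sub _ _ _, by rw [map_sub, map_sub, h2, h2'], map_sub _ _ _⟩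

lemma map {x : (tensorFunctor S.X₃).obj (syz A)} {y : (tensorFunctor S.X₁).obj A}
    (h : IsTensorConnected S x y) {B : ModuleCat.{u} Rᵐᵒᵖ} (f : A ⟶ B) :
    IsTensorConnected S ((tensorFunctor S.X₃).map (syzMap f) x)
      ((tensorFunctor S.X₁).map f y) := by
  obtain ⟨t, z, rfl, h2, rfl⟩ := h
  refine ⟨(tensorFunctor S.X₂).map (syzMap f) t, (tensorFunctor S.X₁).map (syzLift f) z,
    tensorMap_naturality _ _ _, ?_, ?_⟩
  · rw [map_map_apply, syzMap_ι, ← map_map_apply, h2, tensorMap_naturality]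
  · rw [map_map_apply, map_map_apply, syzLift_π]

lemma postcomp {T : ShortComplex (ModuleCat.{u} R)} (α : S ⟶ T)
    {x : (tensorFunctor S.X₃).obj (syz A)} {y : (tensorFunctor S.X₁).obj A}
    (h : IsTensorConnected S x y) :
    IsTensorConnected T ((tensorMap α.τ₃).app _ x) ((tensorMap α.τ₁).app _ y) := by
  obtain ⟨t, z, rfl, h2, rfl⟩ := h
  refine ⟨(tensorMap α.τ₂).app _ t, (tensorMap α.τ₁).app _ z, ?_, ?_, ?_⟩
  · rw [tensorMap_tensorMap, tensorMap_tensorMap, α.comm₂₃]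
  · rw [← tensorMap_naturality, h2, tensorMap_tensorMap, tensorMap_tensorMap, α.comm₁₂]
  · rw [tensorMap_naturality]

-- Single-valuedness from left to right comes from flatness of P, through injectivity of P ⊗ K ⟶ P ⊗
-- L.
include hS in
lemma right_eq_zero {y : (tensorFunctor S.X₁).obj A} (h : IsTensorConnected S 0 y) : y = 0 := by
  obtain ⟨t, z, h1, h2, rfl⟩ := h
  obtain ⟨w, rfl⟩ := (tensor_exact hS _ _).1 h1
  rw [← tensorMap_naturality] at h2
  rw [← injective_tensorMap_of_projective S.f hS.moduleCat_injective_f _ h2]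
  exact (tensorFunctor_map_exact S.X₁ _ _ (syz_exact A) (syz_surjective A)).apply_apply_eq_zero w

-- Single-valuedness from right to left comes from flatness of L, through injectivity of ΩA ⊗ L ⟶ P
-- ⊗ L.
include hS in
lemma left_eq_zero [Module.Finite R S.X₂] [Module.Projective R S.X₂]
    {x : (tensorFunctor S.X₃).obj (syz A)}
    (h : IsTensorConnected S x (0 : (tensorFunctor S.X₁).obj A)) :
    x = 0 := by
  obtain ⟨t, z, rfl, h2, h3⟩ := h
  obtain ⟨w, rfl⟩ := (tensorFunctor_map_exact S.X₁ _ _ (syz_exact A) (syz_surjective A) _).1 h3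
  rw [tensorMap_naturality] at h2
  rw [injective_tensorFunctor_of_projective S.X₂ _ (syz_injective A) h2]
  exact (tensor_exact hS _).apply_apply_eq_zero w

end IsTensorConnected

/-- If `F` is the kernel of `- ⊗_R g`, then `S₁F` is the kernel of `- ⊗_R k`, where `k` is
induced by `g` on syzygies, provided that the middle component is a split monomorphism. -/
theorem IsTensorKernel.leftSatelliteOne {S T : ShortComplex (ModuleCat.{u} R)}
    (hS : S.ShortExact) (hT : T.ShortExact) [Module.Finite R S.X₂] [Module.Projective R S.X₂]
    [Module.Finite R T.X₂] [Module.Projective R T.X₂] (α : S ⟶ T) (r : T.X₂ ⟶ S.X₂)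
    (hr : α.τ₂ ≫ r = 𝟙 _) {F : ModuleCat.{u} Rᵐᵒᵖ ⥤+ AddCommGrpCat.{u}}
    (hF : IsTensorKernel F.obj α.τ₃) : IsTensorKernel (leftSatelliteOne F) α.τ₁ := by
  obtain ⟨ι, hι, hι'⟩ := hF
  let κ (A) : (FunctorDefect.leftSatelliteOne F).obj A ⟶ F.obj.obj (syz A) :=
    kernel.ι (F.obj.map (syzι A))
  have hκ (A) : Function.Injective (κ A) := ab_kernel_ι_injective _
  have hκ' (A) : Function.Exact (κ A) (F.obj.map (syzι A)) := ab_kernel_exact _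
  have hικ (A) (s) : (tensorFunctor S.X₃).map (syzι A) (ι.app _ (κ A s)) = 0 := by
    refine (NatTrans.naturality_apply ι (syzι A) _).symm.trans ?_
    rw [(hκ' A).apply_apply_eq_zero, map_zero]
  obtain ⟨τ, hτ⟩ := exists_natTrans_of_relation (F := FunctorDefect.leftSatelliteOne F)
    (G := tensorFunctor S.X₁) (fun A s y => IsTensorConnected S (ι.app _ (κ A s)) y)
    (fun A s s' y y' h h' => by
      rw [map_sub, map_sub]
      exact h.sub h')
    (fun A s => IsTensorConnected.exists_right hS _ (hικ A s))
    (fun A y h => by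
      rw [map_zero, map_zero] at h
      exact h.right_eq_zero hS)
    (fun A B f s y h => by
      have h1 : κ B ((FunctorDefect.leftSatelliteOne F).map f s) = F.obj.map (syzMap f) (κ A s) :=
        congrArg (fun h => h s) (leftSatelliteMap_ι F f)
      rw [h1]
      exact (NatTrans.naturality_apply ι (syzMap f) _) ▸ h.map f)
  refine ⟨τ, fun A => (injective_iff_map_eq_zero (τ.app A).hom).2 fun s hs => ?_,
    fun A y => ⟨fun hy => ?_, ?_⟩⟩
  · have h := hτ A s
    rw [show τ.app A s = 0 from hs] at h
    apply hκ A
    apply hι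
    rw [h.left_eq_zero hS, map_zero, map_zero]
  -- Since `α.τ₂` is a split monomorphism, so is the map it induces on tensor products. An element
  -- killed by `α.τ₁` is therefore already killed by `S.f`, and so has a partner x.
  · have h1 : (tensorMap S.f).app A y = 0 := by
      have h2 := congrArg ((tensorMap T.f).app A) hy
      rw [map_zero, tensorMap_tensorMap, α.comm₁₂, ← tensorMap_tensorMap] at h2
      have h3 := congrArg ((tensorMap r).app A) h2
      rwa [map_zero, tensorMap_tensorMap, hr, tensorMap_id] at h3
    obtain ⟨x, hx⟩ := IsTensorConnected.exists_left y h1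
    have h4 := hx.postcomp α
    -- The image of x in ΩA ⊗ `T.X₃` is connected to zero, hence zero, so x comes from F(ΩA).
    rw [hy] at h4
    obtain ⟨w, rfl⟩ := (hι' _ x).1 (h4.left_eq_zero hT)
    have h5 := hx.map_left hS
    have h6 : F.obj.map (syzι A) w = 0 := by
      apply hι
      rw [map_zero]
      exact (NatTrans.naturality_apply ι (syzι A) w).trans h5
    obtain ⟨s, rfl⟩ := (hκ' A w).1 h6
    refine ⟨s, sub_eq_zero.1 (IsTensorConnected.right_eq_zero hS ?_)⟩
    simpa using (hτ A s).sub hx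
  · rintro ⟨s, rfl⟩
    have h := (hτ A s).postcomp α
    rw [(hι' _).apply_apply_eq_zero] at h
    exact h.right_eq_zero hT

end LeftSatellite

/-! ### Kernels over a coherent ring -/

section Coherence

variable {S : Type u} [Ring S]

/-- Over a coherent ring the kernel of a linear map between finitely presented modules is finitely
presented. -/
theorem finitePresentation_ker (hS : Nonempty (Abelian (FPMod S))) {X Y : Type u}
    [AddCommGroup X] [Module S X] [AddCommGroup Y] [Module S Y] [Module.FinitePresentation S X]
    [Module.FinitePresentation S Y] (f : X →ₗ[S] Y) :
    Module.FinitePresentation S (LinearMap.ker f) := by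
  have : HasEqualizers (FPMod S) := by
    obtain ⟨h⟩ := hS
    infer_instance
  let X' : FPMod S := ⟨ModuleCat.of S X, ‹_›⟩
  let Y' : FPMod S := ⟨ModuleCat.of S Y, ‹_›⟩
  let S' : FPMod S := ⟨ModuleCat.of S S, inferInstanceAs (Module.FinitePresentation S S)⟩
  let f' : X' ⟶ Y' := ObjectProperty.homMk (ModuleCat.ofHom f)
  let z : X' ⟶ Y' := ObjectProperty.homMk 0
  let E := equalizer f' z
  let i : E.obj →ₗ[S] X := (equalizer.ι f' z).hom.hom
  have hi (e) : f (i e) = 0 :=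
    congrArg (fun h => h.hom.hom e) (equalizer.condition f' z)
  -- Elements of M are morphisms S ⟶ M, and S is itself finitely presented. The abstract equalizer
  -- of f and 0 therefore has the elements of ker f.
  let el {M : FPMod S} (m : M.obj) : S' ⟶ M :=
    ObjectProperty.homMk (ModuleCat.ofHom (LinearMap.toSpanSingleton S M.obj m))
  have hel {M : FPMod S} (m : M.obj) : (el m).hom.hom (1 : S) = m := one_smul S m
  have helc {M N : FPMod S} (m : M.obj) (h : M ⟶ N) : el m ≫ h = el (h.hom.hom m) := by
    ext : 2
    refine LinearMap.ext_ring ?_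
    exact congrArg h.hom.hom (hel m) |>.trans (hel _).symm
  have := E.property
  refine Module.FinitePresentation.of_equiv (R := S) (M := E.obj)
    (LinearEquiv.ofBijective (i.codRestrict _ hi) ⟨fun e e' h => ?_, fun x => ?_⟩)
  · have h1 : i e = i e' := congrArg Subtype.val h
    have h2 : el e ≫ equalizer.ι f' z = el e' ≫ equalizer.ι f' z := by
      rw [helc, helc]
      exact congrArg el h1
    have h3 := congrArg (fun h => h.hom.hom (1 : S)) ((cancel_mono _).1 h2)
    exact (hel e).symm.trans (h3.trans (hel e'))
  · have h1 : el (M := X') x.1 ≫ f' = el (M := X') x.1 ≫ z := by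
      rw [helc, helc]
      exact congrArg el x.2
    refine ⟨(equalizer.lift _ h1).hom.hom (1 : S), Subtype.ext ?_⟩
    exact (congrArg (fun h => h.hom.hom (1 : S)) (equalizer.lift_ι _ h1)).trans (hel (M := X') x.1)

end Coherence

/-! ### One map of syzygies for both satellites -/

section SatelliteStep

variable {R : Type u} [Ring R]

lemma shortExact_ker {L V : Type u} [AddCommGroup L] [Module R L] [AddCommGroup V] [Module R V]
    (p : L →ₗ[R] V) (hp : Function.Surjective p) :
    (ShortComplex.mk (ModuleCat.ofHom (LinearMap.ker p).subtype) (ModuleCat.ofHom p)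
      (by ext x; exact x.2)).ShortExact where
  exact := (ShortComplex.ShortExact.moduleCat_exact_iff_function_exact _).2
    p.exact_subtype_ker_map
  mono_f := (ModuleCat.mono_iff_injective _).2 Subtype.val_injective
  epi_g := (ModuleCat.epi_iff_surjective _).2 hp

/-- Both satellites of the functors determined by `g` are determined by one and the same map of
syzygies. -/
theorem exists_satellite_step (hR : Nonempty (Abelian (FPMod R))) {V₀ V₁ : ModuleCat.{u} R}
    [Module.FinitePresentation R V₀] [Module.FinitePresentation R V₁] (g : V₀ ⟶ V₁) :
    ∃ (K₀ K₁ : ModuleCat.{u} R) (k : K₀ ⟶ K₁), Module.FinitePresentation R K₀ ∧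
      Module.FinitePresentation R K₁ ∧
      (∀ F : ModuleCat.{u} Rᵐᵒᵖ ⥤+ AddCommGrpCat.{u}, IsTensorKernel F.obj g →
        IsTensorKernel (leftSatelliteOne F) k) ∧
      ∀ G : ModuleCat.{u} R ⥤+ AddCommGrpCat.{u}, IsPresentedBy G.obj g →
        IsPresentedBy (rightSatelliteOne G) k := by
  obtain ⟨n, p, hp⟩ := Module.Finite.exists_fin' R V₀
  obtain ⟨m, p', hp'⟩ := Module.Finite.exists_fin' R V₁
  -- The cover of V₁ is enlarged by that of V₀, so that g lifts to the split inclusion of Rⁿ into Rⁿ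
  -- × Rᵐ.
  let q : (Fin n → R) × (Fin m → R) →ₗ[R] V₁ := (g.hom ∘ₗ p).coprod p'
  have hq : Function.Surjective q := fun v => by
    obtain ⟨x, rfl⟩ := hp' v
    exact ⟨(0, x), by simp [q]⟩
  let S := ShortComplex.mk (ModuleCat.ofHom (LinearMap.ker p).subtype)
    (ModuleCat.ofHom p : leftPow R n ⟶ V₀) (by ext x; exact x.2)
  let T := ShortComplex.mk (ModuleCat.ofHom (LinearMap.ker q).subtype)
    (ModuleCat.ofHom q : ModuleCat.of R ((Fin n → R) × (Fin m → R)) ⟶ V₁) (by ext x; exact x.2)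
  have hS : S.ShortExact := shortExact_ker p hp
  have hT : T.ShortExact := shortExact_ker q hq
  let k : LinearMap.ker p →ₗ[R] LinearMap.ker q :=
    (LinearMap.inl R (Fin n → R) (Fin m → R)).restrict (fun x (hx : p x = 0) => by
      simp [q, hx])
  let α : S ⟶ T :=
    { τ₁ := ModuleCat.ofHom k
      τ₂ := ModuleCat.ofHom (LinearMap.inl R (Fin n → R) (Fin m → R))
      τ₃ := g
      comm₁₂ := rfl
      comm₂₃ := by
        refine ConcreteCategory.hom_ext _ _ fun x => ?_
        change q (x, 0) = g.hom (p x)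
        simp [q] }
  have : Module.Finite R S.X₂ := inferInstanceAs (Module.Finite R (Fin n → R))
  have : Module.Projective R S.X₂ := inferInstanceAs (Module.Projective R (Fin n → R))
  have : Module.Finite R T.X₂ := inferInstanceAs (Module.Finite R ((Fin n → R) × (Fin m → R)))
  have : Module.Projective R T.X₂ :=
    inferInstanceAs (Module.Projective R ((Fin n → R) × (Fin m → R)))
  have : Projective S.X₂ := (IsProjective.iff_projective (R := R) S.X₂).1 inferInstance
  have : Projective T.X₂ := (IsProjective.iff_projective (R := R) T.X₂).1 inferInstance
  let r : T.X₂ ⟶ S.X₂ := ModuleCat.ofHom (LinearMap.fst R (Fin n → R) (Fin m → R))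
  have hr : α.τ₂ ≫ r = 𝟙 _ := rfl
  have : Module.FinitePresentation R ((Fin n → R) × (Fin m → R)) :=
    Module.finitePresentation_of_projective R _
  exact ⟨S.X₁, T.X₁, ModuleCat.ofHom k, finitePresentation_ker hR p, finitePresentation_ker hR q,
    fun F hF => IsTensorKernel.leftSatelliteOne hS hT α r hr hF,
    fun G hG => IsPresentedBy.rightSatelliteOne hS hT α r hr hG⟩

/-- The satellite step returns a map of finitely presented modules again, so it can be repeated on
the two functors simultaneously. -/
theorem exists_satellite_iterate (hR : Nonempty (Abelian (FPMod R))) {V₀ V₁ : ModuleCat.{u} R}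
    [Module.FinitePresentation R V₀] [Module.FinitePresentation R V₁] (g : V₀ ⟶ V₁)
    {F : ModuleCat.{u} Rᵐᵒᵖ ⥤+ AddCommGrpCat.{u}} (hF : IsTensorKernel F.obj g)
    {G : ModuleCat.{u} R ⥤+ AddCommGrpCat.{u}} (hG : IsPresentedBy G.obj g) (n : ℕ) :
    ∃ (K₀ K₁ : ModuleCat.{u} R) (k : K₀ ⟶ K₁), Module.FinitePresentation R K₀ ∧
      Module.FinitePresentation R K₁ ∧ IsTensorKernel (leftSatellite n F).obj k ∧
      IsPresentedBy (rightSatellite n G).obj k := by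
  induction n with
  | zero => exact ⟨V₀, V₁, g, ‹_›, ‹_›, hF, hG⟩
  | succ n ih =>
    obtain ⟨K₀, K₁, k, _, _, h, h'⟩ := ih
    obtain ⟨L₀, L₁, l, h1, h2, h3, h4⟩ := exists_satellite_step hR k
    exact ⟨L₀, L₁, l, h1, h2, h3 _ h, h4 _ h'⟩

end SatelliteStep

/-! ### The dual and its independence of the injective copresentation -/

section Dual

/-- The cokernel of (d, -) depends on the two-term complex d only up to homotopy, and the homotopy
relations are needed only at the source of the maps. The generator is transported along `a₀`. -/
lemma IsPresentedBy.of_homotopyEquiv {C : Type u} [Category.{v} C] [Abelian C]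
    {G : C ⥤ AddCommGrpCat.{v}} [G.Additive] {U₀ U₁ W₀ W₁ : C} {d : U₀ ⟶ U₁} {g : W₀ ⟶ W₁}
    (h : IsPresentedBy G d) (a₀ : U₀ ⟶ W₀) (a₁ : U₁ ⟶ W₁) (b₀ : W₀ ⟶ U₀) (b₁ : W₁ ⟶ U₁)
    (s : U₁ ⟶ U₀) (t : W₁ ⟶ W₀) (ha : d ≫ a₁ = a₀ ≫ g) (hb : g ≫ b₁ = b₀ ≫ d)
    (hs : d ≫ s = a₀ ≫ b₀ - 𝟙 _) (ht : g ≫ t = b₀ ≫ a₀ - 𝟙 _) : IsPresentedBy G g := by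
  obtain ⟨x, hx, hx'⟩ := h
  refine ⟨G.map a₀ x, fun A y => ?_, fun A φ => ?_⟩
  · obtain ⟨f, rfl⟩ := hx A y
    refine ⟨b₀ ≫ f, ?_⟩
    rw [map_map_apply, ← sub_eq_zero]
    have h1 := (hx' A (a₀ ≫ b₀ ≫ f - f)).2 ⟨s ≫ f, by
      rw [← Category.assoc, hs, Preadditive.sub_comp, Category.assoc, Category.id_comp]⟩
    rwa [Functor.map_sub] at h1
  · rw [map_map_apply, hx']
    constructor
    · rintro ⟨ψ, hψ⟩
      refine ⟨b₁ ≫ ψ - t ≫ φ, ?_⟩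
      rw [Preadditive.comp_sub, reassoc_of% hb, hψ, ← Category.assoc, ← Category.assoc, ht,
        Preadditive.sub_comp, Category.id_comp, sub_sub_cancel]
    · rintro ⟨χ, rfl⟩
      exact ⟨a₁ ≫ χ, by rw [reassoc_of% ha]⟩

lemma IsPresentedBy.of_iso {C : Type u} [Category.{v} C] [Abelian C]
    {G : C ⥤ AddCommGrpCat.{v}} [G.Additive] {U₀ U₁ W₀ W₁ : C} {d : U₀ ⟶ U₁} {g : W₀ ⟶ W₁}
    (h : IsPresentedBy G d) (e₀ : U₀ ≅ W₀) (e₁ : U₁ ≅ W₁) (he : d ≫ e₁.hom = e₀.hom ≫ g) :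
    IsPresentedBy G g :=
  h.of_homotopyEquiv e₀.hom e₁.hom e₀.inv e₁.inv 0 0 he
    (by rw [Iso.comp_inv_eq, Category.assoc, he, Iso.inv_hom_id_assoc]) (by simp) (by simp)

variable {R : Type u} [Ring R]

/-- The dual of the kernel of `- ⊗_R g`, for `g` a map of finitely presented modules, is the
cokernel of `(g, -)`, whichever injective copresentation is used. -/
theorem InjectiveCopresentation.isPresentedBy_dual {F : FP (ModuleCat.{u} Rᵐᵒᵖ)}
    (I : InjectiveCopresentation F) {V₀ V₁ : ModuleCat.{u} R}
    [Module.FinitePresentation R V₀] [Module.FinitePresentation R V₁] (g : V₀ ⟶ V₁)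
    (hF : IsTensorKernel F.obj.obj g) : IsPresentedBy I.dual.obj.obj g := by
  obtain ⟨ι, hι, hι'⟩ := hF
  have := I.injective₀
  have := I.injective₁
  let T₀ := FP.tensor V₀
  let T₁ := FP.tensor V₁
  let ιT : F ⟶ T₀ := FP.ofNat ι
  have : Mono ιT := FP.mono_of_injective _ hι
  have : Mono I.ι := FP.mono_of_injective _ I.injective
  let b := Injective.factorThru I.ι ιT
  let a := Injective.factorThru ιT I.ι
  have hb : ιT ≫ b = I.ι := Injective.comp_factorThru _ _
  have ha : I.ι ≫ a = ιT := Injective.comp_factorThru _ _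
  let dT : T₀ ⟶ T₁ := FP.ofNat (tensorMap g)
  have hιd : ιT ≫ dT = 0 := FP.hom_ext (by
    ext A x
    exact (hι' A).apply_apply_eq_zero x)
  have hId : I.ι ≫ I.d = 0 := FP.hom_ext (by
    ext A x
    exact (I.exact A).apply_apply_eq_zero x)
  -- The standard comparison of injective resolutions: a and b extend the identity of F, `a₁` and
  -- `b₁` continue them, and s and t exist because `a ≫ b - 𝟙` and `b ≫ a - 𝟙` vanish on F.
  -- Evaluation at R preserves all these identities.
  obtain ⟨a₁, ha₁⟩ := FP.exists_extension (I := T₁) (FP.nat I.ι) (FP.nat I.d) I.exact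
    (FP.nat (a ≫ dT)) (congrArg FP.nat (by rw [reassoc_of% ha, hιd] : I.ι ≫ a ≫ dT = 0))
  obtain ⟨b₁, hb₁⟩ := FP.exists_extension (F := F) (T := T₀) (T' := T₁) (I := I.I₁) ι
    (tensorMap g) hι'
    (FP.nat (b ≫ I.d)) (congrArg FP.nat (by rw [reassoc_of% hb, hId] : ιT ≫ b ≫ I.d = 0))
  obtain ⟨s, hs⟩ := FP.exists_extension (I := I.I₀) (FP.nat I.ι) (FP.nat I.d) I.exact
    (FP.nat (a ≫ b - 𝟙 _)) (congrArg FP.nat (by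
      rw [Preadditive.comp_sub, reassoc_of% ha, hb, Category.comp_id, sub_self] :
        I.ι ≫ (a ≫ b - 𝟙 _) = 0))
  obtain ⟨t, ht⟩ := FP.exists_extension (F := F) (T := T₀) (T' := T₁) (I := T₀) ι
    (tensorMap g) hι'
    (FP.nat (b ≫ a - 𝟙 _)) (congrArg FP.nat (by
      rw [Preadditive.comp_sub, reassoc_of% hb, ha, Category.comp_id, sub_self] :
        ιT ≫ (b ≫ a - 𝟙 _) = 0))
  have h0 : IsPresentedBy I.dual.obj.obj (evalRightRegMap (FP.nat I.d)) := exists_coker_gen _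
  have h1 : IsPresentedBy I.dual.obj.obj
      (evalRightRegMap (F := T₀.obj) (G := T₁.obj) (FP.nat dT)) :=
    h0.of_homotopyEquiv
      (evalRightRegMap (F := I.I₀.obj) (G := T₀.obj) (FP.nat a))
      (evalRightRegMap (F := I.I₁.obj) (G := T₁.obj) a₁)
      (evalRightRegMap (F := T₀.obj) (G := I.I₀.obj) (FP.nat b))
      (evalRightRegMap (F := T₁.obj) (G := I.I₁.obj) b₁)
      (evalRightRegMap (F := I.I₁.obj) (G := I.I₀.obj) s)
      (evalRightRegMap (F := T₁.obj) (G := T₀.obj) t)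
      (congrArg (evalRightRegMap (F := I.I₀.obj) (G := T₁.obj)) ha₁)
      (congrArg (evalRightRegMap (F := T₀.obj) (G := I.I₁.obj)) hb₁)
      (congrArg (evalRightRegMap (F := I.I₀.obj) (G := I.I₀.obj)) hs)
      (congrArg (evalRightRegMap (F := T₀.obj) (G := T₀.obj)) ht)
  exact h1.of_iso (evalTensor V₀) (evalTensor V₁) (evalTensor_naturality g)

end Dual

/-! ### Totally finitely presented functors as kernels of tensor functors -/

section Embedding

variable {R : Type u} [Ring R]

/-- Over a coherent ring a totally finitely presented functor embeds into `- ⊗_R V` for a finitely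
presented module `V`. -/
theorem exists_embedding_tensor (hR : Nonempty (Abelian (FPMod Rᵐᵒᵖ)))
    {F : ModuleCat.{u} Rᵐᵒᵖ ⥤ AddCommGrpCat.{u}} (P : Presentation F)
    [Module.FinitePresentation Rᵐᵒᵖ P.X] [Module.FinitePresentation Rᵐᵒᵖ P.Y] :
    ∃ (V : ModuleCat.{u} R) (_ : Module.FinitePresentation R V) (ι : F ⟶ tensorFunctor V)
      (Q : Presentation (tensorFunctor V)), (∀ A, Function.Injective (ι.app A)) ∧
      Module.FinitePresentation Rᵐᵒᵖ Q.X ∧ Module.FinitePresentation Rᵐᵒᵖ Q.Y := by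
  have exists_cover (M : ModuleCat.{u} Rᵐᵒᵖ) [Module.Finite Rᵐᵒᵖ M] :
      ∃ (n : ℕ) (q : rightPow R n ⟶ M), Function.Surjective q := by
    obtain ⟨n, s, hs⟩ := Module.Finite.exists_fin (R := Rᵐᵒᵖ) (M := M)
    refine ⟨n, rightPowHom s, ?_⟩
    change Function.Surjective (rightPowHom s).hom
    rw [← LinearMap.range_eq_top, ← top_le_iff, ← hs, Submodule.span_le]
    rintro _ ⟨i, rfl⟩
    exact ⟨rightBasis i, rightPowHom_basis s i⟩
  have fpPow (n : ℕ) : Module.FinitePresentation Rᵐᵒᵖ (rightPow R n) := by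
    have : Module.FinitePresentation Rᵐᵒᵖ R :=
      Module.FinitePresentation.of_equiv (MulOpposite.opLinearEquiv Rᵐᵒᵖ (M := R)).symm
    exact inferInstanceAs (Module.FinitePresentation Rᵐᵒᵖ (Fin n → R))
  obtain ⟨m, p, hp⟩ := exists_cover P.Y
  have := fpPow m
  -- The kernel of c is the pullback of X ⟶ Y and the free cover of Y. By coherence it is finitely
  -- generated, so a free module covers it, and P.f is replaced by a map h of free modules.
  let c : P.X × rightPow R m →ₗ[Rᵐᵒᵖ] P.Y := P.f.hom.coprod (-p.hom)
  have := finitePresentation_ker hR c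
  obtain ⟨n, q, hq⟩ := exists_cover (ModuleCat.of Rᵐᵒᵖ (LinearMap.ker c))
  have := fpPow n
  let q₁ : rightPow R n ⟶ P.X :=
    q ≫ ModuleCat.ofHom (LinearMap.fst Rᵐᵒᵖ _ _ ∘ₗ (LinearMap.ker c).subtype)
  let h : rightPow R n ⟶ rightPow R m :=
    q ≫ ModuleCat.ofHom (LinearMap.snd Rᵐᵒᵖ _ _ ∘ₗ (LinearMap.ker c).subtype)
  have hqh : q₁ ≫ P.f = h ≫ p := by
    refine ConcreteCategory.hom_ext _ _ fun x => ?_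
    have := (q x).2
    rw [LinearMap.mem_ker, LinearMap.coprod_apply, LinearMap.neg_apply, ← sub_eq_add_neg,
      sub_eq_zero] at this
    exact this
  obtain ⟨d, hd⟩ := exists_left_transpose h
  -- V is the cokernel of the transpose of h, so that - ⊗ V is presented by h.
  let V := ModuleCat.of R ((Fin n → R) ⧸ LinearMap.range d.hom)
  have hV : Module.FinitePresentation R V :=
    Module.finitePresentation_of_surjective (LinearMap.range d.hom).mkQ
      (Submodule.mkQ_surjective _) (by
        rw [Submodule.ker_mkQ, LinearMap.range_eq_map]
        exact (Module.Finite.fg_top).map _)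
  let Q : Presentation (tensorFunctor V) := tensorPresentation d h hd
    (ModuleCat.ofHom (LinearMap.range d.hom).mkQ : leftPow R n ⟶ V)
    (Submodule.mkQ_surjective _) (LinearMap.exact_map_mkQ_range d.hom)
  obtain ⟨γ, hγ⟩ : ∃ γ : (tensorFunctor V).obj (rightPow R n), ∀ (A : ModuleCat.{u} Rᵐᵒᵖ)
      (x : rightPow R n ⟶ A), (tensorFunctor V).map x γ = 0 ↔ ∃ z : rightPow R m ⟶ A, h ≫ z = x :=
    ⟨Q.gen, fun A x => Q.map_gen_eq_zero_iff x⟩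
  let y : (tensorFunctor V).obj P.X := (tensorFunctor V).map q₁ γ
  obtain ⟨ι, hι⟩ := P.exists_desc (G := tensorFunctor V) y (by
    change (tensorFunctor V).map P.f ((tensorFunctor V).map q₁ γ) = 0
    rw [map_map_apply, hγ]
    exact ⟨p, hqh.symm⟩)
  refine ⟨V, hV, ι, Q, fun A => (injective_iff_map_eq_zero (ι.app A).hom).2 fun a ha => ?_,
    ‹_›, ‹_›⟩
  obtain ⟨x, rfl⟩ := P.exists_map_gen a
  have h1 : (tensorFunctor V).map (q₁ ≫ x) γ = 0 := by
    rw [← map_map_apply]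
    refine (congrArg _ hι.symm).trans ?_
    exact (NatTrans.naturality_apply ι x P.gen).symm.trans ha
  obtain ⟨z, hz⟩ := (hγ _ _).1 h1
  -- Because Rⁿ covers the whole pullback, the equality `h ≫ z = q₁ ≫ x` determines x and z on all
  -- compatible pairs. In particular z kills ker p and descends to Y, which makes x factor through
  -- `P.f`.
  have hlift (x₀ : P.X) (p₀ : rightPow R m) (he : P.f x₀ = p p₀) : x x₀ = z p₀ := by
    obtain ⟨w, hw⟩ := hq ⟨(x₀, p₀), by
      rw [LinearMap.mem_ker, LinearMap.coprod_apply, LinearMap.neg_apply, ← sub_eq_add_neg,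
        sub_eq_zero]
      exact he⟩
    have hw1 : q₁ w = x₀ := congrArg (fun t => t.1.1) hw
    have hw2 : h w = p₀ := congrArg (fun t => t.1.2) hw
    rw [← hw1, ← hw2]
    exact (congrArg (fun f => f w) hz).symm
  have : Epi p := (ModuleCat.epi_iff_surjective _).2 hp
  have hk : kernel.ι p ≫ z = 0 := by
    refine ConcreteCategory.hom_ext _ _ fun k => ?_
    have hk0 : p (kernel.ι p k) = 0 := congrArg (fun f => f k) (kernel.condition p)
    exact (hlift 0 (kernel.ι p k) ((map_zero P.f.hom).trans hk0.symm)).symm.trans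
      (map_zero x.hom)
  refine (P.map_gen_eq_zero_iff x).2 ⟨Abelian.epiDesc p z hk, ?_⟩
  refine ConcreteCategory.hom_ext _ _ fun x₀ => ?_
  obtain ⟨p₀, hp₀⟩ := hp (P.f x₀)
  rw [hlift x₀ p₀ hp₀.symm]
  refine (congrArg (Abelian.epiDesc p z hk) hp₀.symm).trans ?_
  exact congrArg (fun f => f p₀) (Abelian.comp_epiDesc p z hk)

/-- Over a coherent ring a totally finitely presented functor is the kernel of `- ⊗_R g` for a map
`g` of finitely presented left modules. -/
theorem exists_isTensorKernel (hR : Nonempty (Abelian (FPMod Rᵐᵒᵖ)))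
    {F : ModuleCat.{u} Rᵐᵒᵖ ⥤ AddCommGrpCat.{u}} (hF : IsTotallyFinitelyPresented F) :
    ∃ (V₀ V₁ : ModuleCat.{u} R) (g : V₀ ⟶ V₁), Module.FinitePresentation R V₀ ∧
      Module.FinitePresentation R V₁ ∧ IsTensorKernel F g := by
  obtain ⟨P, _, _⟩ := hF
  obtain ⟨V₀, h₀, ι, Q, hι, _, _⟩ := exists_embedding_tensor hR P
  -- The cokernel of F ⟶ - ⊗ V₀ is presented by `Q.X ⟶ Q.Y ⊞ P.X`. It is again totally finitely
  -- presented and embeds into some - ⊗ V₁.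
  obtain ⟨m, q, hq, hιq⟩ := exists_cokernel_sequence P Q ι
  let PQ := cokerPresentation (biprod.lift Q.f m)
  have : Module.FinitePresentation Rᵐᵒᵖ PQ.X := ‹Module.FinitePresentation Rᵐᵒᵖ Q.X›
  have : Module.FinitePresentation Rᵐᵒᵖ PQ.Y :=
    Module.FinitePresentation.of_equiv (ModuleCat.biprodIsoProd Q.Y P.X).toLinearEquiv.symm
  obtain ⟨V₁, h₁, ι', -, hι', -, -⟩ := exists_embedding_tensor hR PQ
  obtain ⟨g, hg⟩ := exists_tensorMap_eq (q ≫ ι')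
  refine ⟨V₀, V₁, g, h₀, h₁, ι, hι, fun A => ?_⟩
  rw [hg]
  intro x
  rw [← hιq A x, ← map_eq_zero_iff (ι'.app A).hom (hι' A)]
  rfl

end Embedding

/-! ### The defect of a kernel of tensor functors -/

section Defect

variable {R : Type u} [Ring R]

/-- Contraction of linear forms on `V` with an element of `A ⊗_R V`. -/
def contract {V : ModuleCat.{u} R} {A : ModuleCat.{u} Rᵐᵒᵖ} (t : (tensorFunctor V).obj A) :
    (V →ₗ[R] R) →ₗ[Rᵐᵒᵖ] A where
  toFun φ := tensorRegular A ((tensorMap (ModuleCat.ofHom φ : V ⟶ leftReg R)).app A t)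
  map_add' φ ψ := by
    induction t using tensor_induction with
    | pure a m =>
      rw [tensorMap_pure, tensorMap_pure, tensorMap_pure]
      exact add_smul (MulOpposite.op (φ m)) (MulOpposite.op (ψ m)) a
    | add x y hx hy =>
      simp only [map_add] at hx hy ⊢
      rw [hx, hy]; abel
  map_smul' r φ := by
    induction t using tensor_induction with
    | pure a m =>
      rw [tensorMap_pure, tensorMap_pure]
      exact mul_smul r (MulOpposite.op (φ m)) a
    | add x y hx hy =>
      simp only [map_add, smul_add] at hx hy ⊢
      rw [hx, hy]

lemma contract_apply {V : ModuleCat.{u} R} {A : ModuleCat.{u} Rᵐᵒᵖ} (t : (tensorFunctor V).obj A)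
    (φ : V ⟶ leftReg R) : contract t φ.hom = tensorRegular A ((tensorMap φ).app A t) :=
  rfl

lemma map_contract {V : ModuleCat.{u} R} {A B : ModuleCat.{u} Rᵐᵒᵖ} (f : A ⟶ B)
    (t : (tensorFunctor V).obj A) (φ : V →ₗ[R] R) :
    f (contract t φ) = contract ((tensorFunctor V).map f t) φ := by
  refine (tensorRegular_naturality f _).symm.trans (congrArg (tensorRegular B) ?_)
  exact (tensorMap_naturality _ f t).symm

/-- For an additive functor `G` on left modules, linear forms on `V` send elements of `G(V)` to
elements of the right module `G(R)`. -/
def mapForm (G : ModuleCat.{u} R ⥤+ AddCommGrpCat.{u}) {V : ModuleCat.{u} R} (x : G.obj.obj V) :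
    (V →ₗ[R] R) →ₗ[Rᵐᵒᵖ] evalLeftReg G :=
  letI := rightModuleAtRing G
  { toFun := fun φ => (G.obj.map (ModuleCat.ofHom φ : V ⟶ leftReg R) x : G.obj.obj (leftReg R))
    map_add' := fun φ ψ => by
      have h : (ModuleCat.ofHom (φ + ψ) : V ⟶ leftReg R) =
        ModuleCat.ofHom φ + ModuleCat.ofHom ψ := rfl
      rw [h, G.obj.map_add]; rfl
    map_smul' := fun r φ => by
      have h : (ModuleCat.ofHom (r • φ) : V ⟶ leftReg R) =
        (ModuleCat.ofHom φ : V ⟶ leftReg R) ≫ mulRightHom r.unop := rfl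
      rw [h, G.obj.map_comp]; rfl }

lemma mapForm_apply (G : ModuleCat.{u} R ⥤+ AddCommGrpCat.{u}) {V : ModuleCat.{u} R}
    (x : G.obj.obj V) (φ : V ⟶ leftReg R) : mapForm G x φ.hom = G.obj.map φ x :=
  rfl

/-- Linear maps with the same kernel have isomorphic ranges. -/
lemma nonempty_linearEquiv_of_ker_eq {S M N N' : Type*} [Ring S] [AddCommGroup M] [Module S M]
    [AddCommGroup N] [Module S N] [AddCommGroup N'] [Module S N'] (f : M →ₗ[S] N)
    (g : M →ₗ[S] N') (hg : Function.Surjective g) (h : LinearMap.ker f = LinearMap.ker g) :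
    Nonempty (LinearMap.range f ≃ₗ[S] N') :=
  ⟨f.quotKerEquivRange.symm ≪≫ₗ Submodule.quotEquivOfEq _ _ h ≪≫ₗ
    g.quotKerEquivOfSurjective hg⟩

/-- The defect of the kernel of `- ⊗_R g` is the value at `R` of the functor presented by `g`. -/
theorem Presentation.nonempty_defect_iso {F : ModuleCat.{u} Rᵐᵒᵖ ⥤ AddCommGrpCat.{u}}
    (P : Presentation F) {V₀ V₁ : ModuleCat.{u} R} [Module.FinitePresentation R V₀]
    [Module.FinitePresentation R V₁] {g : V₀ ⟶ V₁} (hF : IsTensorKernel F g)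
    {G : ModuleCat.{u} R ⥤+ AddCommGrpCat.{u}} (hG : IsPresentedBy G.obj g) :
    Nonempty (P.defect ≅ evalLeftReg G) := by
  have := P.additive
  obtain ⟨ι, hι, hιg⟩ := hF
  obtain ⟨x, hx, hx'⟩ := hG
  let E : FP (ModuleCat.{u} Rᵐᵒᵖ) := ⟨AdditiveFunctor.of F, ⟨P⟩⟩
  let T₀ := FP.tensor V₀
  let T₁ := FP.tensor V₁
  have : Module.FinitePresentation R (leftReg R) :=
    inferInstanceAs (Module.FinitePresentation R R)
  let T := FP.tensor (leftReg R)
  let t := ι.app P.X P.gen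
  have ht : (tensorFunctor V₀).map P.f t = 0 := by
    refine (NatTrans.naturality_apply ι P.f P.gen).symm.trans ?_
    exact (congrArg _ P.map_f_gen).trans (map_zero _)
  -- An element of the defect is a transformation F ⟶ - ⊗ R. By injectivity of - ⊗ R it extends to -
  -- ⊗ V₀, where it is given by a linear form on V₀.
  have hrange : LinearMap.range (contract t) = LinearMap.ker P.f.hom := by
    apply le_antisymm
    · rintro _ ⟨φ, rfl⟩
      refine (map_contract P.f t φ).trans ?_
      rw [ht]
      exact (congrArg _ (map_zero _)).trans (map_zero (tensorRegular P.Y))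
    · intro a ha
      obtain ⟨τ, hτ⟩ := P.exists_desc (G := tensorFunctor (leftReg R))
        ((tensorRegular P.X).symm a) (by
          apply (tensorRegular P.Y).injective
          rw [tensorRegular_naturality, AddEquiv.apply_symm_apply, map_zero]
          exact ha)
      have : Mono (FP.ofNat (F := E) (G := T₀) ι) := FP.mono_of_injective _ hι
      let σ := Injective.factorThru (FP.ofNat (F := E) (G := T) τ)
        (FP.ofNat (F := E) (G := T₀) ι)
      have hσ := congrArg FP.nat (Injective.comp_factorThru (FP.ofNat (F := E) (G := T) τ)
        (FP.ofNat (F := E) (G := T₀) ι))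
      obtain ⟨φ, hφ⟩ := exists_tensorMap_eq (FP.nat σ)
      refine ⟨φ.hom, ?_⟩
      rw [contract_apply, hφ, ← AddEquiv.eq_symm_apply, ← hτ]
      exact congrArg (fun α => α.app P.X P.gen) hσ
  -- A form φ contracts t to zero iff `ι ≫ tensorMap φ` is zero, iff - ⊗ φ extends along - ⊗ g by
  -- injectivity of - ⊗ R, iff φ factors through g. The last condition is the universal relation for
  -- x.
  have hker : LinearMap.ker (contract t) = LinearMap.ker (mapForm G x) := by
    ext φ
    obtain ⟨φ, rfl⟩ : ∃ ψ : V₀ ⟶ leftReg R, ψ.hom = φ := ⟨ModuleCat.ofHom φ, rfl⟩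
    rw [LinearMap.mem_ker, LinearMap.mem_ker, contract_apply, mapForm_apply,
      map_eq_zero_iff _ (tensorRegular P.X).injective]
    refine Iff.trans ?_ (hx' _ φ).symm
    constructor
    · intro h
      have h0 : ι ≫ tensorMap φ = 0 := P.hom_ext h
      obtain ⟨ψ, hψ⟩ := FP.exists_extension (F := E) (T := T₀) (T' := T₁) (I := T) ι
        (tensorMap g) hιg (tensorMap φ) h0
      obtain ⟨y, rfl⟩ := exists_tensorMap_eq ψ
      exact ⟨y, tensorMap_injective ((tensorMap_comp g y).trans hψ)⟩
    · rintro ⟨y, rfl⟩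
      rw [← tensorMap_tensorMap]
      exact (congrArg _ ((hιg P.X).apply_apply_eq_zero P.gen)).trans (map_zero _)
  have hsurj : Function.Surjective (mapForm G x) := fun y => by
    obtain ⟨φ, hφ⟩ := hx (leftReg R) y
    exact ⟨φ.hom, hφ⟩
  obtain ⟨e⟩ := nonempty_linearEquiv_of_ker_eq (contract t) (mapForm G x) hsurj hker
  exact ⟨ModuleCat.kernelIsoKer P.f ≪≫
    ((LinearEquiv.ofEq _ _ hrange.symm) ≪≫ₗ e).toModuleIso⟩

end Defect

/-! ### Tor and Ext by dimension shifting -/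

section ExtTor

variable {R : Type u} [Ring R]

open Abelian (Ext)

/-- Ext⁰(V, -) is (V, -), free on the identity; the zero map imposes no relation. -/
lemma isPresentedBy_extFunctor_zero (V : ModuleCat.{u} R) :
    IsPresentedBy (extFunctor 0 V).obj (0 : V ⟶ V) := by
  have h (A : ModuleCat.{u} R) (f : V ⟶ A) :
      (extFunctor 0 V).obj.map f (Ext.mk₀ (𝟙 V)) = Ext.mk₀ f :=
    (Ext.mk₀_comp_mk₀ (𝟙 V) f).trans (congrArg Ext.mk₀ (Category.id_comp f))
  refine ⟨Ext.mk₀ (𝟙 V), fun A a => ?_, fun A f => ?_⟩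
  · obtain ⟨f, rfl⟩ := (Ext.mk₀_bijective V A).2 a
    exact ⟨f, h A f⟩
  · rw [h]
    constructor
    · intro h0
      have : f = 0 := (Ext.mk₀_bijective V A).1 (h0.trans (Ext.mk₀_zero V A).symm)
      exact ⟨0, by rw [this, comp_zero]⟩
    · rintro ⟨y, rfl⟩
      rw [zero_comp]
      exact Ext.mk₀_zero V A

/-- The generator is the class of the extension. The long exact sequence and the vanishing of
Ext¹(L, -) make Ext¹(V, -) the cokernel of (L, -) ⟶ (K, -). -/
lemma isPresentedBy_extFunctor_one {S : ShortComplex (ModuleCat.{u} R)} (hS : S.ShortExact)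
    [Projective S.X₂] : IsPresentedBy (extFunctor 1 S.X₃).obj S.f := by
  refine ⟨hS.extClass, fun A a => ?_, fun A f => ?_⟩
  · obtain ⟨b, hb⟩ := Ext.contravariant_sequence_exact₃ hS A (a : Ext S.X₃ A 1)
      (Ext.eq_zero_of_projective _) (n₀ := 0) rfl
    obtain ⟨f, rfl⟩ := (Ext.mk₀_bijective S.X₁ A).2 b
    exact ⟨f, hb⟩
  · constructor
    · intro h
      obtain ⟨b, hb⟩ := Ext.contravariant_sequence_exact₁ hS A (Ext.mk₀ f) (n₁ := 1) rfl h
      obtain ⟨y, rfl⟩ := (Ext.mk₀_bijective S.X₂ A).2 b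
      exact ⟨y, (Ext.mk₀_bijective S.X₁ A).1 ((Ext.mk₀_comp_mk₀ S.f y).symm.trans hb)⟩
    · rintro ⟨y, rfl⟩
      change hS.extClass.comp (Ext.mk₀ (S.f ≫ y)) (add_zero 1) = 0
      rw [← Ext.mk₀_comp_mk₀, ← Ext.comp_assoc_of_second_deg_zero, hS.extClass_comp,
        Ext.zero_comp]

/-- Composition with the extension class is an isomorphism from Extⁿ⁺¹(K, -) to Extⁿ⁺²(V, -), since
the positive Ext groups of L vanish. The presenting map g is therefore unchanged. -/
lemma IsPresentedBy.extFunctor_succ {S : ShortComplex (ModuleCat.{u} R)} (hS : S.ShortExact)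
    [Projective S.X₂] {n : ℕ} {V₀ V₁ : ModuleCat.{u} R} {g : V₀ ⟶ V₁}
    (h : IsPresentedBy (extFunctor (n + 1) S.X₁).obj g) :
    IsPresentedBy (extFunctor (n + 2) S.X₃).obj g := by
  obtain ⟨x, hx, hx'⟩ := h
  have hmap (A : ModuleCat.{u} R) (f : V₀ ⟶ A) :
      (extFunctor (n + 2) S.X₃).obj.map f
        (hS.extClass.comp (x : Ext S.X₁ V₀ (n + 1)) (add_comm 1 (n + 1)) : Ext S.X₃ V₀ (n + 2)) =
      hS.extClass.comp ((extFunctor (n + 1) S.X₁).obj.map f x : Ext S.X₁ A (n + 1))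
        (add_comm 1 (n + 1)) :=
    Ext.comp_assoc_of_third_deg_zero _ _ _ _
  refine ⟨hS.extClass.comp (x : Ext S.X₁ V₀ (n + 1)) (add_comm 1 (n + 1)),
    fun A a => ?_, fun A f => ?_⟩
  · obtain ⟨b, hb⟩ := Ext.contravariant_sequence_exact₃ hS A (a : Ext S.X₃ A (n + 2))
      (Ext.eq_zero_of_projective _) (n₀ := n + 1) (add_comm 1 (n + 1))
    obtain ⟨f, rfl⟩ := hx A b
    exact ⟨f, (hmap A f).trans hb⟩
  · rw [hmap, ← hx']
    constructor
    · intro h0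
      obtain ⟨b, hb⟩ := Ext.contravariant_sequence_exact₁ hS A _ (add_comm 1 (n + 1)) h0
      rw [← hb, Ext.eq_zero_of_projective b]
      exact Ext.comp_zero _ _ _ _ _
    · intro h0
      rw [h0]
      exact Ext.comp_zero _ _ _ _ _

/-- Right exactness is what makes the comparison from the zeroth left derived functor an
isomorphism. -/
instance (V : ModuleCat.{u} R) : PreservesFiniteColimits (tensorFunctor V) := by
  rw [Functor.preservesFiniteColimits_iff_forall_exact_map_and_epi]
  intro S hS
  refine ⟨(ShortComplex.ab_exact_iff_function_exact _).2 (tensorFunctor_map_exact V S.f S.g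
    ((ShortComplex.ShortExact.moduleCat_exact_iff_function_exact _).1 hS.exact)
    hS.moduleCat_surjective_g), (AddCommGrpCat.epi_iff_surjective _).2
    (tensorFunctor_map_surjective V S.g hS.moduleCat_surjective_g)⟩

/-- `- ⊗_R S` applied to a complex. -/
def tensorComplexes (S : ShortComplex (ModuleCat.{u} R)) (K : ChainComplex (ModuleCat.{u} Rᵐᵒᵖ) ℕ) :
    ShortComplex (ChainComplex AddCommGrpCat.{u} ℕ) where
  X₁ := ((tensorFunctor S.X₁).mapHomologicalComplex _).obj K
  X₂ := ((tensorFunctor S.X₂).mapHomologicalComplex _).obj K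
  X₃ := ((tensorFunctor S.X₃).mapHomologicalComplex _).obj K
  f := (NatTrans.mapHomologicalComplex (tensorMap S.f) _).app K
  g := (NatTrans.mapHomologicalComplex (tensorMap S.g) _).app K
  zero := by
    ext i : 1
    change (tensorMap S.f ≫ tensorMap S.g).app (K.X i) = 0
    rw [← tensorMap_comp, S.zero, tensorMap_zero]
    rfl

/-- The terms of K are projective, hence flat, so the sequence stays exact in each degree. -/
lemma shortExact_tensorComplexes {S : ShortComplex (ModuleCat.{u} R)} (hS : S.ShortExact)
    (K : ChainComplex (ModuleCat.{u} Rᵐᵒᵖ) ℕ) [∀ i, Projective (K.X i)] :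
    (tensorComplexes S K).ShortExact :=
  HomologicalComplex.shortExact_of_degreewise_shortExact _ fun i =>
    { exact := (ShortComplex.ab_exact_iff_function_exact _).2 (IsTensorConnected.tensor_exact hS _)
      mono_f := (AddCommGrpCat.mono_iff_injective _).2
        (injective_tensorMap_of_projective S.f hS.moduleCat_injective_f (K.X i))
      epi_g := (AddCommGrpCat.epi_iff_surjective _).2
        (tensorMap_surjective S.g hS.moduleCat_surjective_g (K.X i)) }

/-- The map of short complexes induced by a chain map. -/
def tensorComplexesMap (S : ShortComplex (ModuleCat.{u} R))
    {K K' : ChainComplex (ModuleCat.{u} Rᵐᵒᵖ) ℕ} (φ : K ⟶ K') :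
    tensorComplexes S K ⟶ tensorComplexes S K' where
  τ₁ := ((tensorFunctor S.X₁).mapHomologicalComplex _).map φ
  τ₂ := ((tensorFunctor S.X₂).mapHomologicalComplex _).map φ
  τ₃ := ((tensorFunctor S.X₃).mapHomologicalComplex _).map φ
  comm₁₂ := (NatTrans.mapHomologicalComplex (tensorMap S.f) _).naturality φ
  comm₂₃ := (NatTrans.mapHomologicalComplex (tensorMap S.g) _).naturality φ

/-- The higher `Tor` of a finitely generated projective module vanishes. -/
lemma isZero_homology_tensor_of_projective (L : ModuleCat.{u} R) [Module.Finite R L]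
    [Module.Projective R L] {X : ModuleCat.{u} Rᵐᵒᵖ} (P : ProjectiveResolution X) (n : ℕ) :
    IsZero ((((tensorFunctor L).mapHomologicalComplex _).obj P.complex).homology (n + 1)) := by
  rw [← HomologicalComplex.exactAt_iff_isZero_homology,
    HomologicalComplex.exactAt_iff' _ (n + 2) (n + 1) n (by simp) (by simp)]
  refine (ShortComplex.ab_exact_iff_function_exact _).2 ?_
  exact exact_tensorFunctor_of_projective L _ _
    ((ShortComplex.ShortExact.moduleCat_exact_iff_function_exact _).1 (P.exact_succ n))

/-- The comparison `L₀F ⟶ F` is natural in `F`. -/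
lemma leftDerived_comp_fromLeftDerivedZero {C D : Type*} [Category* C] [Category* D] [Abelian C]
    [HasProjectiveResolutions C] [Abelian D] {F G : C ⥤ D} [F.Additive] [G.Additive] (α : F ⟶ G) :
    NatTrans.leftDerived α 0 ≫ G.fromLeftDerivedZero = F.fromLeftDerivedZero ≫ α := by
  ext X
  let P := projectiveResolution X
  let a := (NatTrans.mapHomologicalComplex α (ComplexShape.down ℕ)).app P.complex
  have h : HomologicalComplex.opcyclesMap a 0 ≫ P.fromLeftDerivedZero' G =
      P.fromLeftDerivedZero' F ≫ α.app X := by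
    rw [← cancel_epi (HomologicalComplex.pOpcycles _ _), HomologicalComplex.p_opcyclesMap_assoc,
      ProjectiveResolution.pOpcycles_comp_fromLeftDerivedZero',
      ProjectiveResolution.pOpcycles_comp_fromLeftDerivedZero'_assoc]
    exact (α.naturality (P.π.f 0)).symm
  have h' : HomologicalComplex.homologyMap a 0 ≫ HomologicalComplex.homologyι _ 0 =
      HomologicalComplex.homologyι _ 0 ≫ HomologicalComplex.opcyclesMap a 0 :=
    HomologicalComplex.homologyι_naturality a 0
  rw [NatTrans.comp_app, NatTrans.comp_app, P.leftDerived_app_eq, P.fromLeftDerivedZero_eq,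
    P.fromLeftDerivedZero_eq, Category.assoc, Category.assoc, Iso.inv_hom_id_assoc]
  refine (congrArg (_ ≫ ·) ?_).trans (Category.assoc _ _ _).symm
  change HomologicalComplex.homologyMap a 0 ≫ HomologicalComplex.homologyι _ 0 ≫
      P.fromLeftDerivedZero' G =
    (HomologicalComplex.homologyι _ 0 ≫ P.fromLeftDerivedZero' F) ≫ α.app X
  rw [← Category.assoc, h', Category.assoc, h, Category.assoc]

/-- The connecting morphism `Torₙ₊₁(-, V) ⟶ Torₙ(-, K)` for an exact sequence
`0 ⟶ K ⟶ L ⟶ V ⟶ 0` with `L` projective. -/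
theorem exists_tor_connecting {S : ShortComplex (ModuleCat.{u} R)} (hS : S.ShortExact)
    [Module.Finite R S.X₂] [Module.Projective R S.X₂] (n : ℕ) :
    ∃ δ : torFunctor (n + 1) S.X₃ ⟶ torFunctor n S.X₁,
      (∀ A, Function.Injective (δ.app A)) ∧
      ∀ A, Function.Exact (δ.app A) ((NatTrans.leftDerived (tensorMap S.f) n).app A) := by
  let P (A : ModuleCat.{u} Rᵐᵒᵖ) := projectiveResolution A
  let hP (A : ModuleCat.{u} Rᵐᵒᵖ) := shortExact_tensorComplexes hS (P A).complex
  let e₃ (A : ModuleCat.{u} Rᵐᵒᵖ) : (torFunctor (n + 1) S.X₃).obj A ≅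
      (tensorComplexes S (P A).complex).X₃.homology (n + 1) :=
    (P A).isoLeftDerivedObj (tensorFunctor S.X₃) (n + 1)
  let e₁ (A : ModuleCat.{u} Rᵐᵒᵖ) : (torFunctor n S.X₁).obj A ≅
      (tensorComplexes S (P A).complex).X₁.homology n :=
    (P A).isoLeftDerivedObj (tensorFunctor S.X₁) n
  let e₂ (A : ModuleCat.{u} Rᵐᵒᵖ) : (torFunctor n S.X₂).obj A ≅
      (tensorComplexes S (P A).complex).X₂.homology n :=
    (P A).isoLeftDerivedObj (tensorFunctor S.X₂) n
  let d (A : ModuleCat.{u} Rᵐᵒᵖ) : (tensorComplexes S (P A).complex).X₃.homology (n + 1) ⟶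
      (tensorComplexes S (P A).complex).X₁.homology n := (hP A).δ (n + 1) n rfl
  -- The preceding term of the long exact sequence is Torₙ₊₁(A, L), which vanishes.
  have hd (A) : Mono (d A) := (hP A).mono_δ (n + 1) n rfl
    (isZero_homology_tensor_of_projective S.X₂ (P A) n)
  let δ : torFunctor (n + 1) S.X₃ ⟶ torFunctor n S.X₁ :=
    { app := fun A => (e₃ A).hom ≫ d A ≫ (e₁ A).inv
      naturality := fun A B f => by
        let φ : (P A).complex ⟶ (P B).complex := ProjectiveResolution.lift f (P A) (P B)
        have hφ : φ.f 0 ≫ (P B).π.f 0 = (P A).π.f 0 ≫ f :=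
          ProjectiveResolution.lift_commutes_zero f (P A) (P B)
        let φ₃ := HomologicalComplex.homologyMap (tensorComplexesMap S φ).τ₃ (n + 1)
        let φ₁ := HomologicalComplex.homologyMap (tensorComplexesMap S φ).τ₁ n
        have h3 : (torFunctor (n + 1) S.X₃).map f ≫ (e₃ B).hom = (e₃ A).hom ≫ φ₃ :=
          ProjectiveResolution.isoLeftDerivedObj_hom_naturality f (P A) (P B) φ hφ _ _
        have h1 : (e₁ A).inv ≫ (torFunctor n S.X₁).map f = φ₁ ≫ (e₁ B).inv :=
          ProjectiveResolution.isoLeftDerivedObj_inv_naturality f (P A) (P B) φ hφ _ _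
        have hd : d A ≫ φ₁ = φ₃ ≫ d B :=
          HomologicalComplex.HomologySequence.δ_naturality (tensorComplexesMap S φ)
            (hP A) (hP B) (n + 1) n rfl
        rw [← Category.assoc, h3, Category.assoc, Category.assoc, Category.assoc, h1,
          ← Category.assoc φ₃, ← hd, Category.assoc] }
  refine ⟨δ, fun A => ?_, fun A => ?_⟩
  · apply (AddCommGrpCat.mono_iff_injective _).1
    change Mono ((e₃ A).hom ≫ d A ≫ (e₁ A).inv)
    infer_instance
  · let a := HomologicalComplex.homologyMap (tensorComplexes S (P A).complex).f n
    have ha : (NatTrans.leftDerived (tensorMap S.f) n).app A = (e₁ A).hom ≫ a ≫ (e₂ A).inv :=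
      ProjectiveResolution.leftDerived_app_eq (tensorMap S.f) (P A) n
    have hda : d A ≫ a = 0 := (hP A).δ_comp (n + 1) n rfl
    have hex : (ShortComplex.mk (d A) a hda).Exact := (hP A).homology_exact₁ (n + 1) n rfl
    have hδa : δ.app A ≫ (NatTrans.leftDerived (tensorMap S.f) n).app A = 0 := by
      rw [ha]
      change ((e₃ A).hom ≫ d A ≫ (e₁ A).inv) ≫ (e₁ A).hom ≫ a ≫ (e₂ A).inv = 0
      rw [Category.assoc, Category.assoc, Iso.inv_hom_id_assoc, ← Category.assoc (d A), hda,
        zero_comp, comp_zero]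
    refine (ShortComplex.ab_exact_iff_function_exact (ShortComplex.mk _ _ hδa)).1 ?_
    refine ShortComplex.exact_of_iso (ShortComplex.isoMk (e₃ A).symm (e₁ A).symm (e₂ A).symm
      ?_ ?_) hex
    · change (e₃ A).inv ≫ (e₃ A).hom ≫ d A ≫ (e₁ A).inv = d A ≫ (e₁ A).inv
      rw [Iso.inv_hom_id_assoc]
    · change (e₁ A).inv ≫ (NatTrans.leftDerived (tensorMap S.f) n).app A = a ≫ (e₂ A).inv
      rw [ha]
      exact Iso.inv_hom_id_assoc (e₁ A) _

/-- Tor₀ is the tensor functor itself, the kernel of the zero map. The target V of that zero map is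
chosen to match `isPresentedBy_extFunctor_zero`. -/
lemma isTensorKernel_torFunctor_zero (V : ModuleCat.{u} R) :
    IsTensorKernel (torFunctor 0 V) (0 : V ⟶ V) := by
  refine ⟨(tensorFunctor V).fromLeftDerivedZero, fun A => ?_, fun A x => ?_⟩
  · exact (ConcreteCategory.bijective_of_isIso ((tensorFunctor V).fromLeftDerivedZero.app A)).1
  · rw [tensorMap_zero]
    exact ⟨fun _ => (ConcreteCategory.bijective_of_isIso
      ((tensorFunctor V).fromLeftDerivedZero.app A)).2 x, fun _ => rfl⟩

/-- The connecting morphism embeds Tor₁(-, V) as the kernel of Tor₀(-, K) ⟶ Tor₀(-, L), which the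
comparison with the tensor functors turns into the kernel of - ⊗ K ⟶ - ⊗ L. -/
lemma isTensorKernel_torFunctor_one {S : ShortComplex (ModuleCat.{u} R)} (hS : S.ShortExact)
    [Module.Finite R S.X₂] [Module.Projective R S.X₂] :
    IsTensorKernel (torFunctor 1 S.X₃) S.f := by
  obtain ⟨δ, hδ, hex⟩ := exists_tor_connecting hS 0
  have hinj (V : ModuleCat.{u} R) (A) :
      Function.Bijective ((tensorFunctor V).fromLeftDerivedZero.app A) :=
    ConcreteCategory.bijective_of_isIso _
  have hnat := leftDerived_comp_fromLeftDerivedZero (tensorMap S.f)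
  refine ⟨δ ≫ (tensorFunctor S.X₁).fromLeftDerivedZero,
    fun A => (hinj S.X₁ A).1.comp (hδ A), fun A x => ?_⟩
  obtain ⟨y, rfl⟩ := (hinj S.X₁ A).2 x
  have h1 := congrArg (fun α => α.app A y) hnat
  constructor
  · intro h
    obtain ⟨z, rfl⟩ := (hex A y).1 ((hinj S.X₂ A).1 (h1.trans (h.trans (map_zero _).symm)))
    exact ⟨z, rfl⟩
  · rintro ⟨z, hz⟩
    obtain rfl := (hinj S.X₁ A).1 hz
    refine h1.symm.trans ?_
    refine (congrArg ((tensorFunctor S.X₂).fromLeftDerivedZero.app A)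
      ((hex A).apply_apply_eq_zero z)).trans ?_
    exact map_zero ((tensorFunctor S.X₂).fromLeftDerivedZero.app A).hom

/-- The connecting morphism from Torₙ₊₂(-, V) to Torₙ₊₁(-, K) is an isomorphism, both neighbouring
Tor functors of L being zero. -/
lemma IsTensorKernel.torFunctor_succ {S : ShortComplex (ModuleCat.{u} R)} (hS : S.ShortExact)
    [Module.Finite R S.X₂] [Module.Projective R S.X₂] {n : ℕ} {V₀ V₁ : ModuleCat.{u} R}
    {g : V₀ ⟶ V₁} (h : IsTensorKernel (torFunctor (n + 1) S.X₁) g) :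
    IsTensorKernel (torFunctor (n + 2) S.X₃) g := by
  obtain ⟨δ, hδ, hex⟩ := exists_tor_connecting hS (n + 1)
  obtain ⟨ι, hι, hι'⟩ := h
  have hsurj (A) : Function.Surjective (δ.app A) := fun y => by
    refine (hex A y).1 ?_
    have hz : IsZero ((torFunctor (n + 1) S.X₂).obj A) :=
      (isZero_homology_tensor_of_projective S.X₂ (projectiveResolution A) n).of_iso
        ((projectiveResolution A).isoLeftDerivedObj (tensorFunctor S.X₂) (n + 1))
    exact congrArg (fun α => α y)
      (hz.eq_of_tgt ((NatTrans.leftDerived (tensorMap S.f) (n + 1)).app A) 0)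
  refine ⟨δ ≫ ι, fun A => (hι A).comp (hδ A), fun A x => ((hι' A) x).trans ?_⟩
  constructor
  · rintro ⟨y, rfl⟩
    obtain ⟨z, rfl⟩ := hsurj A y
    exact ⟨z, rfl⟩
  · rintro ⟨z, rfl⟩
    exact ⟨δ.app A z, rfl⟩

lemma exists_shortExact_projective (hR : Nonempty (Abelian (FPMod R))) (V : ModuleCat.{u} R)
    [Module.FinitePresentation R V] :
    ∃ S : ShortComplex (ModuleCat.{u} R), S.ShortExact ∧ S.X₃ = V ∧
      Module.FinitePresentation R S.X₁ ∧ Module.FinitePresentation R S.X₂ ∧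
      Module.Projective R S.X₂ := by
  obtain ⟨m, p, hp⟩ := Module.Finite.exists_fin' R V
  exact ⟨_, shortExact_ker p hp, rfl, finitePresentation_ker hR p,
    inferInstanceAs (Module.FinitePresentation R (Fin m → R)),
    inferInstanceAs (Module.Projective R (Fin m → R))⟩

/-- Over a coherent ring, `Torₙ(-, V)` and `Extⁿ(V, -)` for a finitely presented module `V` are
determined by one and the same map of finitely presented modules. -/
theorem exists_tor_ext (hR : Nonempty (Abelian (FPMod R))) (n : ℕ) (V : ModuleCat.{u} R)
    [Module.FinitePresentation R V] :
    ∃ (V₀ V₁ : ModuleCat.{u} R) (g : V₀ ⟶ V₁), Module.FinitePresentation R V₀ ∧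
      Module.FinitePresentation R V₁ ∧ IsTensorKernel (torFunctor n V) g ∧
      IsPresentedBy (extFunctor n V).obj g := by
  induction n using Nat.strong_induction_on generalizing V with | _ n ih
  obtain _ | n := n
  · exact ⟨V, V, 0, ‹_›, ‹_›, isTensorKernel_torFunctor_zero V, isPresentedBy_extFunctor_zero V⟩
  obtain ⟨S, hS, rfl, hK, hL, _⟩ := exists_shortExact_projective hR V
  have : Projective S.X₂ := IsProjective.iff_projective _ |>.1 inferInstance
  -- Degree one is a second base case: the connecting maps into Tor₀(-, K) and out of Ext⁰(K, -)
  -- need not be isomorphisms.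
  obtain _ | n := n
  · exact ⟨S.X₁, S.X₂, S.f, hK, hL, isTensorKernel_torFunctor_one hS,
      isPresentedBy_extFunctor_one hS⟩
  · obtain ⟨V₀, V₁, g, h₀, h₁, hT, hE⟩ := ih (n + 1) (Nat.lt_succ_self _) S.X₁
    exact ⟨V₀, V₁, g, h₀, h₁, IsTensorKernel.torFunctor_succ hS hT,
      IsPresentedBy.extFunctor_succ hS hE⟩

end ExtTor

/-! ### Conclusion -/

section Main

variable {R : Type u} [Ring R]

lemma IsTensorKernel.nonempty_presentation {F : ModuleCat.{u} Rᵐᵒᵖ ⥤ AddCommGrpCat.{u}}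
    {V₀ V₁ : ModuleCat.{u} R} [Module.FinitePresentation R V₀] [Module.FinitePresentation R V₁]
    {g : V₀ ⟶ V₁} (h : IsTensorKernel F g) : Nonempty (Presentation F) := by
  obtain ⟨ι, hι, hι'⟩ := h
  obtain ⟨P₀⟩ := nonempty_presentation_tensorFunctor V₀
  obtain ⟨P₁⟩ := nonempty_presentation_tensorFunctor V₁
  exact nonempty_presentation_of_exact P₀ P₁ ι _ hι hι'

/-- Tensor functors of finitely presented modules are injective, so the defining sequence is already
a copresentation. -/
lemma IsTensorKernel.nonempty_injectiveCopresentation {F : FP (ModuleCat.{u} Rᵐᵒᵖ)}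
    {V₀ V₁ : ModuleCat.{u} R} [Module.FinitePresentation R V₀] [Module.FinitePresentation R V₁]
    {g : V₀ ⟶ V₁} (h : IsTensorKernel F.obj.obj g) : Nonempty (InjectiveCopresentation F) := by
  obtain ⟨ι, hι, hι'⟩ := h
  exact ⟨{
    I₀ := FP.tensor V₀
    I₁ := FP.tensor V₁
    injective₀ := inferInstance
    injective₁ := inferInstance
    ι := FP.ofNat ι
    d := FP.ofNat (tensorMap g)
    injective := hι
    exact := hι' }⟩

end Main
end FunctorDefect
end

theorem mainTheorem12 (R : Type u) [Ring R] (hR : FunctorDefect.IsCoherentRing R) :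
    (∀ (F : FunctorDefect.FP (ModuleCat.{u} Rᵐᵒᵖ)),
      FunctorDefect.IsTotallyFinitelyPresented F.obj.obj → ∀ n : ℕ,
        FunctorDefect.isFinitelyPresented _ (FunctorDefect.leftSatellite n F.obj) ∧
        Nonempty (FunctorDefect.InjectiveCopresentation F) ∧
        ∀ (P : FunctorDefect.Presentation (FunctorDefect.leftSatellite n F.obj).obj)
          (I : FunctorDefect.InjectiveCopresentation F),
          Nonempty (P.defect ≅
            FunctorDefect.evalLeftReg (FunctorDefect.rightSatellite n I.dual.obj))) ∧
    (∀ (M : ModuleCat.{u} R), Module.FinitePresentation R M → ∀ n : ℕ,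
        Nonempty (FunctorDefect.Presentation (FunctorDefect.torFunctor n M)) ∧
        ∀ P : FunctorDefect.Presentation (FunctorDefect.torFunctor n M),
          Nonempty (P.defect ≅
            FunctorDefect.evalLeftReg (FunctorDefect.extFunctor n M))) := by
  refine ⟨fun F hF n => ?_, fun M _ n => ?_⟩
  -- Coherence on the right provides the embedding into tensor functors, coherence on the left the
  -- finitely presented syzygies.
  · obtain ⟨V₀, V₁, g, _, _, hg⟩ := FunctorDefect.exists_isTensorKernel hR.2 hF
    have hI := hg.nonempty_injectiveCopresentation
    have key (I : FunctorDefect.InjectiveCopresentation F) :=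
      FunctorDefect.exists_satellite_iterate hR.1 g hg (I.isPresentedBy_dual g hg) n
    refine ⟨?_, hI, fun P I => ?_⟩
    -- Any copresentation serves here: only the description of SₙF as a kernel of tensor functors is
    -- extracted.
    · obtain ⟨I⟩ := hI
      obtain ⟨K₀, K₁, k, _, _, hk, -⟩ := key I
      exact hk.nonempty_presentation
    · obtain ⟨K₀, K₁, k, _, _, hk, hk'⟩ := key I
      exact P.nonempty_defect_iso hk hk'
  · obtain ⟨V₀, V₁, g, _, _, hT, hE⟩ := FunctorDefect.exists_tor_ext hR.1 n M
    exact ⟨hT.nonempty_presentation, fun P => P.nonempty_defect_iso hT hE⟩
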